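/- Let $X$ be a locally finite simplicial affine building of dimension $d$ (each apartment is the Coxeter complex of a group generated by the Euclidean reflections along the walls of a compact simplex that is a fundamental domain), with a fixed choice of types $\{0,\dots,d\}$ for which the vertices of type $0$ are special. Let $\operatorname{Aut}(X)$ be the group of automorphisms of the complex which permute the apartments, with the topology of pointwise convergence on vertices. Let $\mathcal C$ be the set of chambers and $P(\mathcal C)=\prod_{c\in\mathcal C}\mathbb C c$. For a chamber $C$ with vertices $v_0,\dots,v_d$ ($v_j$ of type $j$) in an apartment $\mathfrak a$, take $v_0$ as origin, let $\Lambda_0\subset\mathfrak a$ be the lattice of vertices of type $0$, and let $e_j=r_jv_j$ ($1\le j\le d$), where each $r_j>0$ is the largest rational number such that $\Lambda_0\subset\bigoplus_j\mathbb Z e_j$. Let $\operatorname{Cone}(C)$ be the open cone with apex $v_0$ spanned by the interior of $C$; the cone of any other chamber is taken with its own vertex of type $0$ as apex. Let $\mathbb N_0^d(\Lambda_0)$ be the set of $k\in\mathbb N_0^d$ with $\sum_jk_je_j\in\Lambda_0$, and let $\mathbb N^d(\Lambda_0)$ be the subset of those $k$ with all $k_j\ge1$. For $k\in\mathbb N_0^d(\Lambda_0)$,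 a chamber $C'$ is in relative position $k$ to $C$ if, in some apartment containing $C$ and $C'$, the type-$0$ vertex of $C'$ is $\sum_jk_je_j$ and $\operatorname{Cone}(C')\subset\operatorname{Cone}(C)$. The translation operator $T_k$ on $P(\mathcal C)$ is given by $T_k\big(\sum_Ca_CC\big)=\sum_Ca_C\sum_{C'}C'$, where $C'$ runs over the chambers in relative position $k$ to $C$. Let $\Gamma$ be a lattice in $\operatorname{Aut}(X)$, i.e. a discrete subgroup such that the quotient of $\operatorname{Aut}(X)$ by $\Gamma$ carries a nonzero invariant Radon measure of finite volume. Let $P(\mathcal C)^\Gamma$ be the space of $\Gamma$-invariants. **Theorem.** (0) For every $k\in\mathbb N_0^d(\Lambda_0)$ and every chamber $C$, only finitely many chambers are in relative position $k$ to $C$, and $C$ is in relative position $k$ to only finitely many chambers; so $T_k$ is well defined. If $\Gamma$ is type-preserving, every $T_k$ with $k\in\mathbb N_0^d(\Lambda_0)$ maps $P(\mathcal C)^\Gamma$ to itself. Now suppose that every $T_k$, $k\in\mathbb N_0^d(\Lambda_0)$, maps $P(\mathcal C)^\Gamma$ to itself, let $T_{k,\Gamma}$ be its restriction to $P(\mathcal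 C)^\Gamma$, and let $R^\Gamma\subset\operatorname{End}(P(\mathcal C)^\Gamma)$ be the unital subring generated by the $T_{k,\Gamma}$, $k\in\mathbb N_0^d(\Lambda_0)$. (1) The ring $R^\Gamma$ is commutative, and the formal power series $$T_\Gamma(u)=\sum_{k\in\mathbb N^d(\Lambda_0)}u^kT_{k,\Gamma}\in R^\Gamma[[u_1,\dots,u_d]]$$ is a rational function: there are polynomials $P,Q\in R^\Gamma[u_1,\dots,u_d]$ such that $Q$ has constant term $1$ and $Q\cdot T_\Gamma=P$. (2) If $\Gamma$ is uniform, i.e. if $\Gamma\backslash\mathcal C$ is finite, then $P(\mathcal C)^\Gamma$ is finite-dimensional and the power series $Z_\Gamma(u)=\operatorname{tr}T_\Gamma(u)=\sum_{k\in\mathbb N^d(\Lambda_0)}u^k\operatorname{tr}T_{k,\Gamma}$ is a rational function in $\mathbb C(u_1,\dots,u_d)$; more precisely $Z_\Gamma=p/q$ with polynomials $p,q\in\mathbb C[u_1,\dots,u_d]$, where $q$ has constant term $1$. -/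

import Mathlib

open MeasureTheory

noncomputable section

/-! ### Euclidean simplices generating an affine reflection group -/

/-- The reflections along the walls of the simplex with vertices `v 0, …, v d`: the reflection along
the wall opposite to `v j` is the only nontrivial isometry which fixes all other vertices. -/
def wallReflections {d : ℕ} (v : Fin (d + 1) → EuclideanSpace ℝ (Fin d)) :
    Set (EuclideanSpace ℝ (Fin d) ≃ᵃⁱ[ℝ] EuclideanSpace ℝ (Fin d)) :=
  {g | g ≠ 1 ∧ ∃ j, ∀ i, i ≠ j → g (v i) = v i}

/-- The group generated by the reflections along the walls of a simplex. -/
def reflectionGroup {d : ℕ} (v : Fin (d + 1) → EuclideanSpace ℝ (Fin d)) :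
    Subgroup (EuclideanSpace ℝ (Fin d) ≃ᵃⁱ[ℝ] EuclideanSpace ℝ (Fin d)) :=
  Subgroup.closure (wallReflections v)

/-- A nondegenerate simplex in Euclidean `d`-space with vertices labelled `0, …, d`, which is a
fundamental domain for the group generated by the reflections along its walls. The group is
then an irreducible affine Weyl group and the simplex is a Weyl chamber. -/
structure CoxeterSimplex (d : ℕ) where
  v : Fin (d + 1) → EuclideanSpace ℝ (Fin d)
  indep : AffineIndependent ℝ v
  disjoint_interior : ∀ w ∈ reflectionGroup v, w ≠ 1 →
    Disjoint (w '' interior (convexHull ℝ (Set.range v))) (interior (convexHull ℝ (Set.range v)))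
  cover : ∀ x, ∃ w ∈ reflectionGroup v, w x ∈ convexHull ℝ (Set.range v)

namespace CoxeterSimplex

variable {d : ℕ} (M : CoxeterSimplex d)

/-- The affine Weyl group. -/
abbrev weylGroup : Subgroup (EuclideanSpace ℝ (Fin d) ≃ᵃⁱ[ℝ] EuclideanSpace ℝ (Fin d)) :=
  reflectionGroup M.v

/-- A reflection hyperplane of the affine Weyl group. -/
def IsReflectionHyperplane (H : AffineSubspace ℝ (EuclideanSpace ℝ (Fin d))) : Prop :=
  (H : Set (EuclideanSpace ℝ (Fin d))).Nonempty ∧ Module.finrank ℝ H.direction + 1 = d ∧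
    ∃ g ∈ M.weylGroup, g ≠ 1 ∧ ∀ x ∈ H, g x = x

/-- The vertex of label `0` is special: the reflection hyperplanes through it meet every
parallelity class of reflection hyperplanes. -/
def IsSpecial : Prop :=
  ∀ H, M.IsReflectionHyperplane H →
    ∃ H', M.IsReflectionHyperplane H' ∧ M.v 0 ∈ H' ∧ H'.direction = H.direction

/-- The vertices of the Coxeter complex. -/
def Vertex : Type :=
  {x : EuclideanSpace ℝ (Fin d) // ∃ w ∈ M.weylGroup, ∃ j, w (M.v j) = x}

/-- The vertex with label `j` of the chamber `w C₀`, where `C₀` is the given simplex. -/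
def vertex (w : M.weylGroup) (j : Fin (d + 1)) : M.Vertex :=
  ⟨w.1 (M.v j), w.1, w.2, j, rfl⟩

/-- The simplices of the Coxeter complex: the nonempty sets of vertices of some chamber `w C₀`. -/
def faces : Set (Finset M.Vertex) :=
  {s | s.Nonempty ∧ ∃ w : M.weylGroup, ∀ x ∈ s, ∃ j, x = M.vertex w j}

/-- `Λ₀`: the vertices of type zero, as vectors with respect to the origin `v₀`. -/
def typeZeroLattice : Set (EuclideanSpace ℝ (Fin d)) :=
  {x | ∃ w ∈ M.weylGroup, x = w (M.v 0) - M.v 0}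

/-- The vectors `e_j = r_j v_j`, for `j = 1, …, d`, with respect to the origin `v₀`. -/
def basisVec (r : Fin d → ℚ) (j : Fin d) : EuclideanSpace ℝ (Fin d) :=
  (r j : ℝ) • (M.v j.succ - M.v 0)

/-- `Λ = ⨁ ℤ e_j`. -/
def ambientLattice (r : Fin d → ℚ) : AddSubgroup (EuclideanSpace ℝ (Fin d)) :=
  AddSubgroup.closure (Set.range (M.basisVec r))

/-- Each `r_j` is the largest positive rational number such that `Λ₀ ⊆ Λ`. -/
def IsScale (r : Fin d → ℚ) : Prop :=
  IsGreatest {q : Fin d → ℚ | (∀ j, 0 < q j) ∧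
    M.typeZeroLattice ⊆ (M.ambientLattice q : Set (EuclideanSpace ℝ (Fin d)))} r

/-- The vector `∑ k_j e_j`. -/
def latticeVec (r : Fin d → ℚ) (k : Fin d →₀ ℕ) : EuclideanSpace ℝ (Fin d) :=
  ∑ j, k j • M.basisVec r j

/-- `ℕ₀ᵈ(Λ₀)`: the set of all `k ∈ ℕ₀ᵈ` such that `∑ k_j e_j` lies in `Λ₀`. -/
def admissible (r : Fin d → ℚ) : Set (Fin d →₀ ℕ) :=
  {k | M.latticeVec r k ∈ M.typeZeroLattice}

/-- The open cone with apex `v₀` spanned by the interior of the simplex. -/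
def cone : Set (EuclideanSpace ℝ (Fin d)) :=
  {x | ∃ t : ℝ, 0 < t ∧ ∃ y ∈ interior (convexHull ℝ (Set.range M.v)),
    x = M.v 0 + t • (y - M.v 0)}

/-- `w C₀` is the chamber `C₀(k)`: its vertex of type zero is `∑ k_j e_j`, and its cone, with this
vertex as apex, is contained in the cone of `C₀`. -/
def IsPosition (r : Fin d → ℚ) (k : Fin d →₀ ℕ) (w : M.weylGroup) : Prop :=
  w.1 (M.v 0) = M.v 0 + M.latticeVec r k ∧ w.1 '' M.cone ⊆ M.cone

/-- `φ` is an isomorphism from the Coxeter complex onto the complex with set of simplices `a`. -/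
def IsIsoOnto {V : Type*} (φ : M.Vertex ↪ V) (a : Set (Finset V)) : Prop :=
  a = (fun s => s.map φ) '' M.faces

end CoxeterSimplex

/-! ### Affine buildings -/

/-- A simplicial affine building whose apartments are isomorphic to the Coxeter complex of `M`,
together with a choice of types, normalized to agree with the labels of `M`.
Subcomplexes are given by their sets of simplices. -/
structure AffineBuilding {d : ℕ} (M : CoxeterSimplex d) (V : Type*) extends
    AbstractSimplicialComplex V where
  lab : V → Fin (d + 1)
  apartments : Set (Set (Finset V))
  /-- The complex is the union of its apartments. -/
  union_apartments : faces = ⋃₀ apartments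
  /-- Every apartment is a Coxeter complex. -/
  exists_chart : ∀ a ∈ apartments, ∃ φ : M.Vertex ↪ V,
    M.IsIsoOnto φ a ∧ ∀ w j, lab (φ (M.vertex w j)) = j
  /-- Any two chambers are contained in a common apartment. -/
  exists_apartment : ∀ c ∈ faces, ∀ c' ∈ faces, c.card = d + 1 → c'.card = d + 1 →
    ∃ a ∈ apartments, c ∈ a ∧ c' ∈ a
  /-- For apartments `a`, `b` containing a chamber `c` and a simplex `s` there is an isomorphism
  `ψ ∘ φ⁻¹ : a → b` which fixes `c` and `s` pointwise. -/
  exists_iso : ∀ a ∈ apartments, ∀ b ∈ apartments, ∀ c ∈ a ∩ b, ∀ s ∈ a ∩ b, c.card = d + 1 →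
    ∃ φ ψ : M.Vertex ↪ V, M.IsIsoOnto φ a ∧ M.IsIsoOnto ψ b ∧
      ∀ x, φ x ∈ c ∨ φ x ∈ s → ψ x = φ x

/-- A lattice in a topological group `G`: a discrete subgroup `Γ` such that `G ⧸ Γ` carries a
nonzero `G`-invariant Radon measure of finite volume. -/
def IsGroupLattice {G : Type*} [Group G] [TopologicalSpace G] (Γ : Subgroup G) : Prop :=
  DiscreteTopology Γ ∧
    letI : MeasurableSpace (G ⧸ Γ) := borel (G ⧸ Γ)
    ∃ μ : Measure (G ⧸ Γ), μ ≠ 0 ∧ IsFiniteMeasure μ ∧ μ.Regular ∧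
      ∀ g : G, μ.map (fun x => g • x) = μ

namespace AffineBuilding

variable {d : ℕ} {M : CoxeterSimplex d} {V : Type*} (X : AffineBuilding M V)

/-- Every vertex lies in only finitely many simplices. -/
def IsLocallyFinite : Prop :=
  ∀ v : V, {s ∈ X.faces | v ∈ s}.Finite

/-- The chambers: the simplices of maximal dimension `d`. -/
def Chamber : Type _ := {c : Finset V // c ∈ X.faces ∧ c.card = d + 1}

/-- The automorphism group: automorphisms of the complex mapping apartments to apartments. -/
def aut : Subgroup (Equiv.Perm V) where
  carrier := {g | (∀ s : Finset V, s.map g.toEmbedding ∈ X.faces ↔ s ∈ X.faces) ∧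
    ∀ a : Set (Finset V),
      (fun s : Finset V => s.map g.toEmbedding) '' a ∈ X.apartments ↔ a ∈ X.apartments}
  one_mem' := by
    have h : ∀ s : Finset V, s.map (1 : Equiv.Perm V).toEmbedding = s := fun s =>
      Finset.map_refl
    simp [h]
  mul_mem' := by
    rintro g h ⟨hg, hg'⟩ ⟨hh, hh'⟩
    have e : ∀ s : Finset V, s.map (g * h).toEmbedding
        = (s.map h.toEmbedding).map g.toEmbedding := fun s => by
      rw [Finset.map_map]; rfl
    refine ⟨fun s => by rw [e, hg, hh], fun a => ?_⟩
    rw [← hh' a, ← hg' ((fun s : Finset V => s.map h.toEmbedding) '' a), Set.image_image]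
    simp only [e]
  inv_mem' := by
    rintro g ⟨hg, hg'⟩
    have e : ∀ s : Finset V, (s.map (g⁻¹).toEmbedding).map g.toEmbedding = s := fun s => by
      rw [Finset.map_map]; ext x; simp
    refine ⟨fun s => by rw [← hg, e], fun a => ?_⟩
    rw [← hg', Set.image_image]
    simp only [e, Set.image_id']

/-- The topology of `Aut(X)`: pointwise convergence on the discrete set of vertices, so that the
pointwise stabilizers of finite sets are a basis of the unit neighborhoods. -/
instance : TopologicalSpace X.aut :=
  TopologicalSpace.induced (fun g => (g.1 : V → V)) (@Pi.topologicalSpace V (fun _ => V) fun _ => ⊥)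

/-- The action of `Aut(X)` on the set of chambers. -/
instance : MulAction X.aut X.Chamber where
  smul g c := ⟨c.1.map g.1.toEmbedding, (g.2.1 c.1).2 c.2.1, by
    rw [Finset.card_map]; exact c.2.2⟩
  one_smul c := Subtype.ext (by
    change c.1.map (1 : Equiv.Perm V).toEmbedding = c.1
    exact Finset.map_refl)
  mul_smul g h c := Subtype.ext (by
    change c.1.map (g.1 * h.1).toEmbedding = (c.1.map h.1.toEmbedding).map g.1.toEmbedding
    rw [Finset.map_map]; rfl)

/-- The chamber `c'` is in relative position `k` to `c`: some type-preserving identification of an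
apartment containing `c` and `c'` with the Coxeter complex takes `c` to `C₀` and `c'` to `C₀(k)`. -/
def RelPos (r : Fin d → ℚ) (k : Fin d →₀ ℕ) (c c' : X.Chamber) : Prop :=
  ∃ a ∈ X.apartments, ∃ φ : M.Vertex ↪ V,
    M.IsIsoOnto φ a ∧ (∀ w j, X.lab (φ (M.vertex w j)) = j) ∧
    (c.1 : Set V) = Set.range (fun j => φ (M.vertex 1 j)) ∧
    ∃ w : M.weylGroup, M.IsPosition r k w ∧
      (c'.1 : Set V) = Set.range (fun j => φ (M.vertex w j))

open Classical in
/-- The translation operator `T_k` on `P(𝒞) = ∏_c ℂ c`, extending `c ↦ ∑ c'`, the sum over all `c'`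
in relative position `k` to `c`: the coefficient of `T_k (∑ f_c c)` at `c'` is the sum of the `f_c`
over all `c` to which `c'` is in relative position `k`. (These sums are finite if `X` is locally
finite; the value `0` is a convention for the other case.) -/
def T (r : Fin d → ℚ) (k : Fin d →₀ ℕ) : Module.End ℂ (X.Chamber → ℂ) where
  toFun f c' := if h : {c | X.RelPos r k c c'}.Finite then ∑ c ∈ h.toFinset, f c else 0
  map_add' f g := by
    funext c'
    by_cases h : {c | X.RelPos r k c c'}.Finite
    · simp [h, Finset.sum_add_distrib]
    · simp [h]
  map_smul' z f := by
    funext c'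
    by_cases h : {c | X.RelPos r k c c'}.Finite
    · simp [h, Finset.mul_sum]
    · simp [h]

/-- `P(𝒞)^Γ`. -/
def invariants (Γ : Subgroup X.aut) : Submodule ℂ (X.Chamber → ℂ) where
  carrier := {f | ∀ γ ∈ Γ, ∀ c, f (γ • c) = f c}
  add_mem' hf hg γ hγ c := by simp [hf γ hγ c, hg γ hγ c]
  zero_mem' γ _ c := rfl
  smul_mem' z f hf γ hγ c := by simp [hf γ hγ c]

/-- All `T_k`, `k ∈ ℕ₀ᵈ(Λ₀)`, map `P(𝒞)^Γ` to itself. -/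
def Preserves (r : Fin d → ℚ) (Γ : Subgroup X.aut) : Prop :=
  ∀ k ∈ M.admissible r, ∀ f ∈ X.invariants Γ, X.T r k f ∈ X.invariants Γ

variable {X} {r : Fin d → ℚ} {Γ : Subgroup X.aut}

/-- `T_{k,Γ}`, the restriction of `T_k` to `P(𝒞)^Γ`. -/
def TRes (hT : X.Preserves r Γ) (k : M.admissible r) : Module.End ℂ (X.invariants Γ) :=
  (X.T r k).restrict (hT k k.2)

/-- The unital subring of `End(P(𝒞)^Γ)` generated by the `T_{k,Γ}`, `k ∈ ℕ₀ᵈ(Λ₀)`. -/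
def coeffRing (hT : X.Preserves r Γ) : Subring (Module.End ℂ (X.invariants Γ)) :=
  Subring.closure (Set.range (TRes hT))

open Classical in
/-- `T_Γ(u) = ∑ u^k T_{k,Γ}`, the sum over all `k ∈ ℕ₀ᵈ(Λ₀)` with all `k_j ≥ 1`. -/
def TSeries (hT : X.Preserves r Γ) : MvPowerSeries (Fin d) (coeffRing hT) :=
  fun k => if h : k ∈ M.admissible r ∧ ∀ j, 1 ≤ k j then
    ⟨TRes hT ⟨k, h.1⟩, Subring.subset_closure ⟨_, rfl⟩⟩ else 0

/-- `Z_Γ(u) = tr T_Γ(u)`. -/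
def zetaSeries (hT : X.Preserves r Γ) : MvPowerSeries (Fin d) ℂ :=
  fun k => LinearMap.trace ℂ (X.invariants Γ) (MvPowerSeries.coeff k (TSeries hT)).1

end AffineBuilding

/-- A formal power series `F` is a rational function with coefficients in `R`: `F = Q⁻¹ P` with
polynomials `P`, `Q` over `R`, where `Q` has constant term `1`, hence is invertible as a power
series. -/
def IsRationalSeries {σ R : Type*} [Ring R] (F : MvPowerSeries σ R) : Prop :=
  ∃ P Q : MvPowerSeries σ R,
    {n | MvPowerSeries.coeff n P ≠ 0}.Finite ∧ {n | MvPowerSeries.coeff n Q ≠ 0}.Finite ∧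
    MvPowerSeries.constantCoeff Q = 1 ∧ Q * F = P

end

noncomputable section

/-! ### Reflections -/

/-! Everything reduces to the identity T_k T_l = T_{k+l} (`T_mul_T`). Since v₀ is special, Λ₀ is
exactly the set of translation vectors of the affine Weyl group W, and the only element of W in
position k is the translation t_k by ∑ k_j e_j (`isPosition_iff`). So T_k sums over pairs of
chambers at W-valued distance t_k, and the identity follows from two facts.

In W, a reduced word of t_l stays length-increasing when it is read from t_k onwards
(`isReducedOver_of_dominant`). The reason is that every reflection hyperplane has a parallel one
through v₀ which does not cut the base chamber, so its linear form has constant sign on the cone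
(`linear_sign`): translating by two vectors of the closed cone never crosses a parallel class in
opposite directions.

In the building, W-distances multiply along length-increasing words and the intermediate chamber is
unique (`Rel.mul_of_reducedOver`, `Rel.between_unique`). This rests on the rigidity of charts
(`IsChart.agree`) and on folding galleries (`exists_folded_word`).

For rationality, Λ₀ has full rank because W has a compact fundamental domain, so it contains N e_j
for some N > 0. If m_j ≥ 1, the coefficient of T_Γ at m + N e_j is T_{N e_j} times the one at m;
hence 1 - T_{N e_j} u_j^N makes the series bounded in u_j, and the product of these factors over j
is a denominator. Traces are not multiplicative, but Cayley–Hamilton for T_{N e_j} still gives a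
linear recurrence in each variable, so the same criterion `isRationalSeries_of_recurrence` applies.
-/

/-- A linear isometry different from `1` which fixes the kernel of a linear form pointwise is the
orthogonal reflection in this kernel. -/
theorem LinearIsometryEquiv.apply_eq_of_fixes_ker {E : Type*} [NormedAddCommGroup E]
    [InnerProductSpace ℝ E] [FiniteDimensional ℝ E] (α : E →ₗ[ℝ] ℝ) :
    ∃ n : E, ∀ L : E ≃ₗᵢ[ℝ] E, (∀ x, α x = 0 → L x = x) → (∃ x, L x ≠ x) →
      ∀ x, L x = x - (2 * α x) • n := by
  set m : E := (InnerProductSpace.toDual ℝ E).symm (LinearMap.toContinuousLinearMap α) with hm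
  have hα : ∀ x, α x = inner ℝ m x := fun x => by
    rw [hm, InnerProductSpace.toDual_symm_apply]; rfl
  refine ⟨(inner ℝ m m)⁻¹ • m, fun L hL hne => ?_⟩
  have hm0 : m ≠ 0 := by
    intro h0
    obtain ⟨x, hx⟩ := hne
    exact hx (hL x (by rw [hα, h0, inner_zero_left]))
  have hmm : inner ℝ m m ≠ 0 := by simpa using hm0
  have dec : ∀ x : E, L (x - (α x * (inner ℝ m m)⁻¹) • m) = x - (α x * (inner ℝ m m)⁻¹) • m := by
    intro x
    apply hL
    rw [_root_.map_sub, _root_.map_smul, hα m, smul_eq_mul]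
    field_simp
    ring
  set c : ℝ := α (L m) * (inner ℝ m m)⁻¹ with hc
  -- The difference y lies in the kernel of α, so L fixes it and ⟨L m, y⟩ = ⟨m, y⟩ = 0. Thus y is
  -- orthogonal to L m and to m, hence to itself.
  have hLm : L m = c • m := by
    rw [← sub_eq_zero, ← inner_self_eq_zero (𝕜 := ℝ)]
    set y := L m - c • m with hy
    have hαy : α y = 0 := by
      rw [hy, _root_.map_sub, _root_.map_smul, hα m, hc, smul_eq_mul]; field_simp; ring
    have h1 : inner ℝ (L m) y = 0 := by
      have h2 : inner ℝ (L m) (L y) = inner ℝ m y := L.inner_map_map m y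
      rw [hL y hαy] at h2
      rw [h2, ← hα, hαy]
    have h3 : inner ℝ m y = 0 := by rw [← hα, hαy]
    nth_rewrite 1 [hy]
    rw [inner_sub_left, h1, real_inner_smul_left, h3, mul_zero, sub_zero]
  have hnorm : c * c = 1 := by
    have h2 : inner ℝ (L m) (L m) = inner ℝ m m := L.inner_map_map m m
    rw [hLm, real_inner_smul_left, real_inner_smul_right] at h2
    have : (c * c - 1) * inner ℝ m m = 0 := by linarith
    rcases mul_eq_zero.1 this with h | h
    · linarith
    · exact absurd h hmm
  have hform : ∀ x, L x = x + (α x * (inner ℝ m m)⁻¹ * (c - 1)) • m := by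
    intro x
    have h := dec x
    rw [_root_.map_sub, _root_.map_smul, hLm, sub_eq_iff_eq_add] at h
    rw [h]
    module
  have hc1 : c = -1 := by
    rcases mul_self_eq_one_iff.1 hnorm with h | h
    · obtain ⟨x, hx⟩ := hne
      refine absurd ?_ hx
      rw [hform, h]; simp
    · exact h
  intro x
  rw [hform, hc1]
  module

/-! ### Barycentric coordinates and freeness of the action on chambers. -/

namespace CoxeterSimplex

variable {d : ℕ} (M : CoxeterSimplex d)

/-- The vertices of the simplex as an affine basis. -/
def basis : AffineBasis (Fin (d + 1)) ℝ (EuclideanSpace ℝ (Fin d)) :=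
  ⟨M.v, M.indep, by
    rw [M.indep.affineSpan_eq_top_iff_card_eq_finrank_add_one]; simp⟩

/-- The barycentric coordinates with respect to the simplex. -/
abbrev coord (j : Fin (d + 1)) : EuclideanSpace ℝ (Fin d) →ᵃ[ℝ] ℝ := M.basis.coord j

theorem coord_self (j : Fin (d + 1)) : M.coord j (M.v j) = 1 := M.basis.coord_apply_eq j

theorem coord_ne {i j : Fin (d + 1)} (h : i ≠ j) : M.coord j (M.v i) = 0 :=
  M.basis.coord_apply_ne h.symm

/-- The points with positive barycentric coordinates. -/
def Pos (x : EuclideanSpace ℝ (Fin d)) : Prop := ∀ i, 0 < M.coord i x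

theorem mem_interior {x : EuclideanSpace ℝ (Fin d)} :
    x ∈ interior (convexHull ℝ (Set.range M.v)) ↔ M.Pos x := by
  have h := M.basis.interior_convexHull
  have h2 : Set.range M.basis = Set.range M.v := rfl
  rw [h2] at h
  rw [h]; rfl

/-- The barycenter. -/
def center : EuclideanSpace ℝ (Fin d) := Finset.univ.centroid ℝ M.v

theorem pos_center : M.Pos M.center := by
  intro i
  have := M.basis.coord_apply_centroid (s := Finset.univ) (i := i) (Finset.mem_univ i)
  have h2 : M.coord i M.center = (Finset.univ.card : ℝ)⁻¹ := this
  rw [h2]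
  simp
  positivity

theorem eq_one_of_pos (w : M.weylGroup) {x : EuclideanSpace ℝ (Fin d)} (hx : M.Pos x)
    (hwx : M.Pos (w.1 x)) : w = 1 := by
  by_contra hw
  have h := M.disjoint_interior w.1 w.2 (fun h => hw (Subtype.ext h))
  exact Set.disjoint_left.1 h ⟨x, M.mem_interior.2 hx, rfl⟩ (M.mem_interior.2 hwx)

theorem inv_apply_self (w : M.weylGroup) (x : EuclideanSpace ℝ (Fin d)) :
    (w⁻¹).1 (w.1 x) = x := by
  have : (w⁻¹ * w).1 x = x := by rw [inv_mul_cancel]; rfl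
  exact this

theorem apply_inv_self (w : M.weylGroup) (x : EuclideanSpace ℝ (Fin d)) :
    w.1 ((w⁻¹).1 x) = x := by
  have : (w * w⁻¹).1 x = x := by rw [mul_inv_cancel]; rfl
  exact this

theorem affineMap_apply {F : Type*} [AddCommGroup F] [Module ℝ F]
    (h : EuclideanSpace ℝ (Fin d) →ᵃ[ℝ] F) (x : EuclideanSpace ℝ (Fin d)) :
    h x = ∑ i, M.coord i x • h (M.v i) := by
  conv_lhs => rw [← M.basis.affineCombination_coord_eq_self x]
  rw [Finset.map_affineCombination _ _ _ (M.basis.sum_coord_apply_eq_one x),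
    Finset.affineCombination_eq_linear_combination _ _ _ (M.basis.sum_coord_apply_eq_one x)]
  rfl

theorem affineMap_apply_of_zero {F : Type*} [AddCommGroup F] [Module ℝ F]
    (h : EuclideanSpace ℝ (Fin d) →ᵃ[ℝ] F) {j : Fin (d + 1)} (h0 : ∀ i, i ≠ j → h (M.v i) = 0)
    (x : EuclideanSpace ℝ (Fin d)) : h x = M.coord j x • h (M.v j) := by
  rw [M.affineMap_apply h x]
  refine Finset.sum_eq_single j (fun i _ hi => by rw [h0 i hi, smul_zero]) (by simp)

/-- An affine map fixing all vertices fixes the barycenter, an interior point of the simplex, and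
the open simplex is disjoint from its nontrivial translates under W. -/
theorem eq_one_of_fixes (w : M.weylGroup) (h : ∀ i, w.1 (M.v i) = M.v i) : w = 1 := by
  refine M.eq_one_of_pos w M.pos_center ?_
  have h1 : w.1 M.center = M.center := by
    have h2 := M.affineMap_apply (w.1.toAffineEquiv : _ →ᵃ[ℝ] EuclideanSpace ℝ (Fin d)) M.center
    have h3 := M.affineMap_apply (AffineMap.id ℝ (EuclideanSpace ℝ (Fin d))) M.center
    have h4 : w.1 M.center = ∑ i, M.coord i M.center • w.1 (M.v i) := h2
    have h5 : M.center = ∑ i, M.coord i M.center • M.v i := h3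
    rw [h4]
    simp only [h]
    exact h5.symm
  rw [h1]; exact M.pos_center

theorem eq_of_apply_eq {w u : M.weylGroup} (h : ∀ i, w.1 (M.v i) = u.1 (M.v i)) : w = u := by
  have : u⁻¹ * w = 1 := M.eq_one_of_fixes _ fun i => by
    change (u⁻¹).1 (w.1 (M.v i)) = _
    rw [h, inv_apply_self]
  exact (inv_mul_eq_one.1 this).symm

/-! ### Reflections along the walls of the simplex. -/

/-- `s` is the reflection along the wall opposite to the vertex `j`. -/
def IsWall (j : Fin (d + 1)) (s : M.weylGroup) : Prop :=
  s ≠ 1 ∧ ∀ i, i ≠ j → s.1 (M.v i) = M.v i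

variable {M}

theorem IsWall.inv {j : Fin (d + 1)} {s : M.weylGroup} (hs : M.IsWall j s) : M.IsWall j s⁻¹ :=
  ⟨inv_ne_one.2 hs.1, fun i hi => by
    conv_lhs => rw [← hs.2 i hi]
    exact M.inv_apply_self s _⟩

theorem IsWall.apply {j : Fin (d + 1)} {s : M.weylGroup} (hs : M.IsWall j s)
    (x : EuclideanSpace ℝ (Fin d)) : s.1 x = x + M.coord j x • (s.1 (M.v j) - M.v j) := by
  have h := M.affineMap_apply_of_zero
    ((s.1.toAffineEquiv : _ →ᵃ[ℝ] EuclideanSpace ℝ (Fin d)) - AffineMap.id ℝ _) (j := j)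
    (fun i hi => sub_eq_zero.2 (hs.2 i hi)) x
  have h2 : s.1 x - x = M.coord j x • (s.1 (M.v j) - M.v j) := h
  rw [← h2]; abel

theorem IsWall.apply_of_coord_eq_zero {j : Fin (d + 1)} {s : M.weylGroup} (hs : M.IsWall j s)
    {x : EuclideanSpace ℝ (Fin d)} (hx : M.coord j x = 0) : s.1 x = x := by
  rw [hs.apply, hx, zero_smul, add_zero]

theorem IsWall.pos_dim {j : Fin (d + 1)} {s : M.weylGroup} (hs : M.IsWall j s) : 0 < d := by
  rcases Nat.eq_zero_or_pos d with rfl | h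
  · exact absurd (M.eq_one_of_fixes s fun i => Subsingleton.elim _ _) hs.1
  · exact h

theorem IsWall.exists_index_ne {j : Fin (d + 1)} {s : M.weylGroup} (hs : M.IsWall j s) :
    ∃ i : Fin (d + 1), i ≠ j := by
  have := hs.pos_dim
  have : Nontrivial (Fin (d + 1)) := Fin.nontrivial_iff_two_le.2 (by omega)
  exact exists_ne j

theorem linear_apply (g : EuclideanSpace ℝ (Fin d) ≃ᵃⁱ[ℝ] EuclideanSpace ℝ (Fin d))
    (x y : EuclideanSpace ℝ (Fin d)) : g.linearIsometryEquiv x = g (x + y) - g y := by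
  have := g.map_vadd y x
  simp only [vadd_eq_add] at this
  rw [this]; abel

theorem IsWall.linear_apply {j : Fin (d + 1)} {s : M.weylGroup} (hs : M.IsWall j s)
    (x : EuclideanSpace ℝ (Fin d)) :
    s.1.linearIsometryEquiv x = x + (M.coord j).linear x • (s.1 (M.v j) - M.v j) := by
  rw [CoxeterSimplex.linear_apply s.1 x 0, hs.apply, hs.apply 0]
  have : M.coord j (x + 0) = (M.coord j).linear x + M.coord j 0 := (M.coord j).map_vadd 0 x
  rw [this]
  module

/-- Isometries with a common linear part and a common value agree. -/
theorem eq_of_linear_eq {g g' : EuclideanSpace ℝ (Fin d) ≃ᵃⁱ[ℝ] EuclideanSpace ℝ (Fin d)}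
    (h : g.linearIsometryEquiv = g'.linearIsometryEquiv) {p : EuclideanSpace ℝ (Fin d)}
    (hp : g p = g' p) : g = g' := by
  ext1 x
  have h1 := CoxeterSimplex.linear_apply g (x - p) p
  have h2 := CoxeterSimplex.linear_apply g' (x - p) p
  rw [h, h2, hp, sub_add_cancel] at h1
  exact (sub_left_inj.1 h1).symm

theorem IsWall.exists_linear_ne {j : Fin (d + 1)} {s : M.weylGroup} (hs : M.IsWall j s) :
    ∃ x, s.1.linearIsometryEquiv x ≠ x := by
  by_contra! h
  obtain ⟨i, hi⟩ := hs.exists_index_ne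
  apply hs.1
  apply Subtype.ext
  refine eq_of_linear_eq (p := M.v i) ?_ (hs.2 i hi)
  ext1 x
  rw [h]; rfl

/-- Both linear parts are nontrivial isometries fixing the kernel of the same linear form, so they
are the same reflection; a common fixed vertex determines the translation part. -/
theorem IsWall.unique {j : Fin (d + 1)} {s s' : M.weylGroup} (hs : M.IsWall j s)
    (hs' : M.IsWall j s') : s = s' := by
  obtain ⟨n, hn⟩ := LinearIsometryEquiv.apply_eq_of_fixes_ker (M.coord j).linear
  have key : ∀ {t : M.weylGroup}, M.IsWall j t → ∀ x, t.1.linearIsometryEquiv x =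
      x - (2 * (M.coord j).linear x) • n := fun {t} ht =>
    hn _ (fun x hx => by rw [ht.linear_apply, hx, zero_smul, add_zero]) ht.exists_linear_ne
  obtain ⟨i, hi⟩ := hs.exists_index_ne
  apply Subtype.ext
  refine eq_of_linear_eq (p := M.v i) ?_ ((hs.2 i hi).trans (hs'.2 i hi).symm)
  ext1 x
  rw [key hs, key hs']

theorem IsWall.inv_eq {j : Fin (d + 1)} {s : M.weylGroup} (hs : M.IsWall j s) : s⁻¹ = s :=
  hs.inv.unique hs

theorem IsWall.mul_self {j : Fin (d + 1)} {s : M.weylGroup} (hs : M.IsWall j s) : s * s = 1 := by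
  rw [mul_eq_one_iff_eq_inv, hs.inv_eq]

/-! ### Hyperplanes fixed by Weyl group elements, and the chambers on their two sides. -/

/-- An affine function whose zero set is fixed by a nontrivial Weyl group element does not change
its sign on the simplex. -/
theorem nonneg_of_fixes {z : M.weylGroup} (hz : z ≠ 1) (h : EuclideanSpace ℝ (Fin d) →ᵃ[ℝ] ℝ)
    (hfix : ∀ x, h x = 0 → z.1 x = x) {x : EuclideanSpace ℝ (Fin d)} (hx : M.Pos x)
    (hpos : 0 ≤ h x) (i : Fin (d + 1)) : 0 ≤ h (M.v i) := by
  by_contra! hneg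
  -- The parameter at which h vanishes on the segment from x to the vertex. As t < 1, that zero is
  -- still an interior point of the simplex, and z would fix it.
  set t : ℝ := h x / (h x - h (M.v i)) with ht
  have hden : 0 < h x - h (M.v i) := by linarith
  have ht0 : 0 ≤ t := by positivity
  have ht1 : t < 1 := by rw [ht, div_lt_one hden]; linarith
  have hy : h (AffineMap.lineMap x (M.v i) t) = 0 := by
    rw [AffineMap.apply_lineMap, AffineMap.lineMap_apply_ring', ht]
    field_simp
    ring
  have hyp : M.Pos (AffineMap.lineMap x (M.v i) t) := by
    intro j
    rw [AffineMap.apply_lineMap, AffineMap.lineMap_apply_ring]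
    have h1 := hx j
    have h2 : 0 ≤ M.coord j (M.v i) := by
      by_cases hij : i = j
      · rw [hij, M.coord_self]; norm_num
      · rw [M.coord_ne hij]
    have : 0 < (1 - t) * M.coord j x := mul_pos (by linarith) h1
    have : 0 ≤ t * M.coord j (M.v i) := mul_nonneg ht0 h2
    linarith
  exact hz (M.eq_one_of_pos z hyp (by rw [hfix _ hy]; exact hyp))

theorem ne_zero_of_fixes {z : M.weylGroup} (hz : z ≠ 1) (h : EuclideanSpace ℝ (Fin d) →ᵃ[ℝ] ℝ)
    (hfix : ∀ x, h x = 0 → z.1 x = x) {x : EuclideanSpace ℝ (Fin d)} (hx : M.Pos x) : h x ≠ 0 :=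
  fun h0 => hz (M.eq_one_of_pos z hx (by rw [hfix _ h0]; exact hx))

variable (M)

/-- The composite of an affine function with the Weyl group element `u`. -/
def pull (h : EuclideanSpace ℝ (Fin d) →ᵃ[ℝ] ℝ) (u : M.weylGroup) :
    EuclideanSpace ℝ (Fin d) →ᵃ[ℝ] ℝ :=
  h.comp (u.1.toAffineEquiv : EuclideanSpace ℝ (Fin d) →ᵃ[ℝ] EuclideanSpace ℝ (Fin d))

theorem pull_apply (h : EuclideanSpace ℝ (Fin d) →ᵃ[ℝ] ℝ) (u : M.weylGroup)
    (x : EuclideanSpace ℝ (Fin d)) : M.pull h u x = h (u.1 x) := rfl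

variable {M}

/-- If the fixed hyperplane of `z` separates adjacent chambers, then it is their common wall. -/
theorem eq_conj_of_separates {z u s : M.weylGroup} {i : Fin (d + 1)} (hs : M.IsWall i s)
    (hz : z ≠ 1) (h : EuclideanSpace ℝ (Fin d) →ᵃ[ℝ] ℝ) (hfix : ∀ x, h x = 0 → z.1 x = x)
    (h1 : 0 ≤ h (u.1 M.center)) (h2 : h ((u * s).1 M.center) ≤ 0) : z * u = u * s := by
  have key : ∀ y : M.weylGroup, ∀ g : EuclideanSpace ℝ (Fin d) →ᵃ[ℝ] ℝ,
      (∀ x, g x = 0 → z.1 x = x) → 0 ≤ g (y.1 M.center) → ∀ k, 0 ≤ g (y.1 (M.v k)) := by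
    intro y g hg hy k
    refine nonneg_of_fixes (z := y⁻¹ * z * y) (fun h => hz ?_) (M.pull g y) (fun x hx => ?_)
      M.pos_center hy k
    · rw [mul_eq_one_iff_eq_inv, inv_mul_eq_iff_eq_mul, mul_inv_cancel] at h
      exact h
    · change (y⁻¹).1 (z.1 (y.1 x)) = x
      have hx' : g (y.1 x) = 0 := hx
      rw [hg _ hx', inv_apply_self]
  have hp := key u h hfix h1
  have hq := key (u * s) (-h) (fun x hx => hfix x (by simpa using hx)) (by simpa using h2)
  -- The vertices of u C₀ other than the i-th also belong to u s C₀. There h is both nonnegative and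
  -- nonpositive, so they lie on the hyperplane fixed by z.
  have hwall : M.IsWall i (u⁻¹ * z * u) := by
    refine ⟨fun h => hz ?_, fun k hk => ?_⟩
    · rw [mul_eq_one_iff_eq_inv, inv_mul_eq_iff_eq_mul, mul_inv_cancel] at h
      exact h
    · change (u⁻¹).1 (z.1 (u.1 (M.v k))) = M.v k
      have hk1 := hp k
      have hk2 : 0 ≤ - h (u.1 (s.1 (M.v k))) := hq k
      rw [hs.2 k hk] at hk2
      rw [hfix _ (by linarith), inv_apply_self]
  have := hwall.unique hs
  rw [← this]
  group

end CoxeterSimplex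

namespace CoxeterSimplex

variable {d : ℕ} (M : CoxeterSimplex d)

/-! ### Word length -/

/-- A list of reflections along walls of the simplex. -/
def IsWord (L : List M.weylGroup) : Prop := ∀ s ∈ L, ∃ j, M.IsWall j s

/-- The word length of a Weyl group element. -/
def len (w : M.weylGroup) : ℕ := sInf {n | ∃ L, M.IsWord L ∧ L.prod = w ∧ L.length = n}

variable {M}

theorem IsWord.nil : M.IsWord [] := by simp [IsWord]

theorem IsWord.cons {s : M.weylGroup} {j : Fin (d + 1)} {L : List M.weylGroup} (hs : M.IsWall j s)
    (hL : M.IsWord L) : M.IsWord (s :: L) := by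
  intro t ht
  rcases List.mem_cons.1 ht with rfl | ht
  · exact ⟨j, hs⟩
  · exact hL t ht

theorem IsWord.tail {s : M.weylGroup} {L : List M.weylGroup} (hL : M.IsWord (s :: L)) :
    M.IsWord L := fun t ht => hL t (List.mem_cons_of_mem _ ht)

theorem IsWord.head {s : M.weylGroup} {L : List M.weylGroup} (hL : M.IsWord (s :: L)) :
    ∃ j, M.IsWall j s := hL s List.mem_cons_self

theorem IsWord.append {L L' : List M.weylGroup} (hL : M.IsWord L) (hL' : M.IsWord L') :
    M.IsWord (L ++ L') := by
  intro t ht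
  rcases List.mem_append.1 ht with h | h
  · exact hL t h
  · exact hL' t h

theorem IsWord.inv {L : List M.weylGroup} (hL : M.IsWord L) :
    M.IsWord (L.map fun x => x⁻¹).reverse := by
  intro t ht
  rw [List.mem_reverse, List.mem_map] at ht
  obtain ⟨s, hs, rfl⟩ := ht
  obtain ⟨j, hj⟩ := hL s hs
  exact ⟨j, hj.inv⟩

theorem exists_word (w : M.weylGroup) : ∃ L, M.IsWord L ∧ L.prod = w := by
  obtain ⟨w, hw⟩ := w
  induction hw using Subgroup.closure_induction with
  | mem x hx =>
    obtain ⟨h1, j, h2⟩ := hx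
    exact ⟨[⟨x, Subgroup.subset_closure ⟨h1, j, h2⟩⟩],
      IsWord.nil.cons (j := j) ⟨fun h => h1 (congrArg Subtype.val h), h2⟩, by simp⟩
  | one => exact ⟨[], IsWord.nil, rfl⟩
  | mul x y hx hy ihx ihy =>
    obtain ⟨L, hL, hLx⟩ := ihx
    obtain ⟨L', hL', hLy⟩ := ihy
    exact ⟨L ++ L', hL.append hL', by rw [List.prod_append, hLx, hLy]; rfl⟩
  | inv x hx ih =>
    obtain ⟨L, hL, hLx⟩ := ih
    exact ⟨_, hL.inv, by rw [← List.prod_inv_reverse, hLx]; rfl⟩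

theorem exists_reduced_word (w : M.weylGroup) :
    ∃ L, M.IsWord L ∧ L.prod = w ∧ L.length = M.len w := by
  obtain ⟨L, hL, hw⟩ := exists_word w
  exact Nat.sInf_mem (s := {n | ∃ L, M.IsWord L ∧ L.prod = w ∧ L.length = n}) ⟨_, L, hL, hw, rfl⟩

theorem len_prod_le {L : List M.weylGroup} (hL : M.IsWord L) : M.len L.prod ≤ L.length :=
  Nat.sInf_le ⟨L, hL, rfl, rfl⟩

theorem len_inv_le (w : M.weylGroup) : M.len w⁻¹ ≤ M.len w := by
  obtain ⟨L, hL, hw, hlen⟩ := exists_reduced_word w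
  have h := len_prod_le hL.inv
  rw [← List.prod_inv_reverse, hw] at h
  simpa [hlen] using h

theorem len_inv (w : M.weylGroup) : M.len w⁻¹ = M.len w :=
  le_antisymm (len_inv_le w) (by simpa using len_inv_le w⁻¹)

theorem len_mul_le (w u : M.weylGroup) : M.len (w * u) ≤ M.len w + M.len u := by
  obtain ⟨L, hL, hw, hlen⟩ := exists_reduced_word w
  obtain ⟨L', hL', hu, hlen'⟩ := exists_reduced_word u
  have h := len_prod_le (hL.append hL')
  rwa [List.prod_append, hw, hu, List.length_append, hlen, hlen'] at h

theorem IsWall.len_le_one {j : Fin (d + 1)} {s : M.weylGroup} (hs : M.IsWall j s) :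
    M.len s ≤ 1 := by
  simpa using len_prod_le (IsWord.nil.cons hs)

/-- Deletion of a letter at a crossing of the fixed hyperplane of `z`. -/
theorem exists_shorter_word {z : M.weylGroup} (hz : z ≠ 1)
    (h : EuclideanSpace ℝ (Fin d) →ᵃ[ℝ] ℝ) (hfix : ∀ x, h x = 0 → z.1 x = x) :
    ∀ (L : List M.weylGroup), M.IsWord L → ∀ u : M.weylGroup, h (u.1 M.center) < 0 →
      0 < h ((u * L.prod).1 M.center) →
      ∃ L', M.IsWord L' ∧ L'.length < L.length ∧ z * u * L.prod = u * L'.prod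
  | [], _, u, h1, h2 => by
    rw [List.prod_nil, mul_one] at h2
    exact absurd h2 (not_lt.2 h1.le)
  | t :: L, hL, u, h1, h2 => by
    obtain ⟨i, ht⟩ := hL.head
    by_cases hc : h ((u * t).1 M.center) < 0
    · rw [List.prod_cons, ← mul_assoc] at h2
      obtain ⟨L', hL', hlen, he⟩ := exists_shorter_word hz h hfix L hL.tail (u * t) hc h2
      refine ⟨t :: L', hL'.cons ht, by simpa using hlen, ?_⟩
      rw [List.prod_cons, List.prod_cons, ← mul_assoc u, ← he]
      group
    -- This letter is the crossing: z u = u t, so applying z to the remaining gallery cancels the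
    -- letter t.
    · refine ⟨L, hL.tail, by simp, ?_⟩
      have := eq_conj_of_separates ht hz (-h) (fun x hx => hfix x (by simpa using hx)) (u := u)
        (by simpa using h1.le) (by simpa using hc)
      rw [this, List.prod_cons, mul_assoc u, ← mul_assoc t, ht.mul_self, one_mul]

theorem pull_fixes {j : Fin (d + 1)} {s : M.weylGroup} (hs : M.IsWall j s) (w : M.weylGroup)
    (x : EuclideanSpace ℝ (Fin d)) (hx : M.pull (M.coord j) w⁻¹ x = 0) :
    (w * s * w⁻¹).1 x = x := by
  change w.1 (s.1 ((w⁻¹).1 x)) = x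
  have hx' : M.coord j ((w⁻¹).1 x) = 0 := hx
  rw [hs.apply_of_coord_eq_zero hx', apply_inv_self]

theorem IsWall.conj_ne_one {j : Fin (d + 1)} {s : M.weylGroup} (hs : M.IsWall j s)
    (w : M.weylGroup) : w * s * w⁻¹ ≠ 1 := fun h => hs.1 (conj_eq_one_iff.1 h)

/-- The hyperplane of the reflection w s w⁻¹ separates C₀ from w C₀, so a reduced gallery between
them crosses it. Reflecting the part after the crossing leads to w s C₀ with a letter saved. -/
theorem len_mul_lt {j : Fin (d + 1)} {s : M.weylGroup} (hs : M.IsWall j s) {w : M.weylGroup}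
    (h : M.coord j ((w⁻¹).1 M.center) < 0) : M.len (w * s) < M.len w := by
  obtain ⟨L, hL, hw, hlen⟩ := exists_reduced_word w
  obtain ⟨L', hL', hlen', he⟩ := exists_shorter_word (hs.conj_ne_one w) _ (pull_fixes hs w) L hL 1 h
    (by rw [pull_apply, hw, one_mul, inv_apply_self]; exact M.pos_center j)
  rw [hw, mul_one, inv_mul_cancel_right, one_mul] at he
  rw [he, ← hlen]
  exact (len_prod_le hL').trans_lt hlen'

/-- The map s adds the multiple given by the j-th coordinate of a fixed nonzero vector; since s is
an involution, the coordinates of x and s x must cancel. -/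
theorem IsWall.coord_apply {j : Fin (d + 1)} {s : M.weylGroup} (hs : M.IsWall j s)
    (x : EuclideanSpace ℝ (Fin d)) : M.coord j (s.1 x) = - M.coord j x := by
  have h1 : s.1 (s.1 x) = x := by
    have : (s * s).1 x = x := by rw [hs.mul_self]; rfl
    exact this
  rw [hs.apply (s.1 x)] at h1
  nth_rewrite 1 [hs.apply x] at h1
  rw [add_assoc, ← add_smul, add_eq_left, smul_eq_zero] at h1
  rcases h1 with h1 | h1
  · linarith
  · exfalso
    refine hs.1 (M.eq_one_of_fixes s fun i => ?_)
    by_cases hi : i = j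
    · rw [hi]; exact sub_eq_zero.1 h1
    · exact hs.2 i hi

theorem lt_len_mul {j : Fin (d + 1)} {s : M.weylGroup} (hs : M.IsWall j s) {w : M.weylGroup}
    (h : 0 < M.coord j ((w⁻¹).1 M.center)) : M.len w < M.len (w * s) := by
  have h1 := len_mul_lt hs (w := w * s) (by
    rw [mul_inv_rev, hs.inv_eq]
    change M.coord j (s.1 ((w⁻¹).1 M.center)) < 0
    rw [hs.coord_apply]
    linarith)
  rwa [mul_assoc, hs.mul_self, mul_one] at h1

theorem coord_pos_of_lt_len {j : Fin (d + 1)} {s : M.weylGroup} (hs : M.IsWall j s)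
    {w : M.weylGroup} (h : M.len w < M.len (w * s)) : 0 < M.coord j ((w⁻¹).1 M.center) := by
  have hne : M.coord j ((w⁻¹).1 M.center) ≠ 0 :=
    ne_zero_of_fixes (hs.conj_ne_one w) (M.pull (M.coord j) w⁻¹) (pull_fixes hs w) M.pos_center
  rcases lt_or_gt_of_ne hne with h1 | h1
  · exact absurd (len_mul_lt hs h1) (not_lt.2 h.le)
  · exact h1

theorem coord_neg_of_len_lt {j : Fin (d + 1)} {s : M.weylGroup} (hs : M.IsWall j s)
    {w : M.weylGroup} (h : M.len (w * s) < M.len w) : M.coord j ((w⁻¹).1 M.center) < 0 := by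
  have hne : M.coord j ((w⁻¹).1 M.center) ≠ 0 :=
    ne_zero_of_fixes (hs.conj_ne_one w) (M.pull (M.coord j) w⁻¹) (pull_fixes hs w) M.pos_center
  rcases lt_or_gt_of_ne hne with h1 | h1
  · exact h1
  · exact absurd (lt_len_mul hs h1) (not_lt.2 h.le)

/-! ### Translations -/

/-- Specialness applied to the j-th wall of the chamber u C₀: the element g fixes the parallel
hyperplane through v₀. -/
theorem exists_parallel (hM : M.IsSpecial) {j : Fin (d + 1)} {s : M.weylGroup}
    (hs : M.IsWall j s) (u : M.weylGroup) :
    ∃ g : M.weylGroup, g ≠ 1 ∧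
      ∀ x, (M.pull (M.coord j) u⁻¹).linear (x - M.v 0) = 0 → g.1 x = x := by
  set h := M.pull (M.coord j) u⁻¹ with hh
  obtain ⟨i, hi⟩ := hs.exists_index_ne
  have hui : h (u.1 (M.v i)) = 0 := by rw [hh, pull_apply, inv_apply_self, M.coord_ne hi]
  have huj : h (u.1 (M.v j)) = 1 := by rw [hh, pull_apply, inv_apply_self, M.coord_self]
  have hlin : ∀ x y, h.linear (x - y) = h x - h y := fun x y => h.linearMap_vsub x y
  have hne : h.linear ≠ 0 := by
    intro h0
    have h1 := hlin (u.1 (M.v j)) (u.1 (M.v i))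
    rw [h0, hui, huj] at h1
    norm_num at h1
  obtain ⟨H', ⟨hne', hdim', g, hg, hg1, hgfix⟩, hv, hdir⟩ :=
    hM (AffineSubspace.mk' (u.1 (M.v i)) (LinearMap.ker h.linear))
      ⟨⟨_, AffineSubspace.self_mem_mk' _ _⟩, by
      rw [AffineSubspace.direction_mk', Module.Dual.finrank_ker_add_one_of_ne_zero hne]; simp,
      (u * s * u⁻¹).1, (u * s * u⁻¹).2, fun h1 => hs.conj_ne_one u (Subtype.ext h1), fun x hx => by
        rw [AffineSubspace.mem_mk', LinearMap.mem_ker, vsub_eq_sub, hlin, hui, sub_zero] at hx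
        exact pull_fixes hs u x hx⟩
  refine ⟨⟨g, hg⟩, fun h1 => hg1 (congrArg Subtype.val h1), fun x hx => hgfix x ?_⟩
  rw [AffineSubspace.direction_mk'] at hdir
  have := AffineSubspace.vadd_mem_of_mem_direction (s := H') (v := x - M.v 0) (by
    rw [hdir]; exact hx) hv
  simpa using this

/-- The analogue of a root being positive or negative: the parallel hyperplane through v₀ is fixed
by a nontrivial element, so it does not cut the open simplex. -/
theorem linear_sign (hM : M.IsSpecial) {j : Fin (d + 1)} {s : M.weylGroup}
    (hs : M.IsWall j s) (u : M.weylGroup) :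
    (∀ k, 0 ≤ (M.pull (M.coord j) u⁻¹).linear (M.v k - M.v 0)) ∨
      ∀ k, 0 ≤ (-(M.pull (M.coord j) u⁻¹).linear) (M.v k - M.v 0) := by
  obtain ⟨g, hg, hfix⟩ := exists_parallel hM hs u
  set α := (M.pull (M.coord j) u⁻¹).linear
  set h : EuclideanSpace ℝ (Fin d) →ᵃ[ℝ] ℝ :=
    α.toAffineMap.comp (AffineMap.id ℝ _ - AffineMap.const ℝ _ (M.v 0)) with hh
  have hx : ∀ x, h x = α (x - M.v 0) := fun x => rfl
  rcases le_total 0 (h M.center) with h1 | h1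
  · left
    intro k
    exact nonneg_of_fixes hg h (fun x h0 => hfix x (by rwa [hx] at h0)) M.pos_center h1 k
  · right
    intro k
    have := nonneg_of_fixes hg (-h) (fun x h0 => hfix x (by
      have h2 : -(h x) = 0 := h0
      rw [hx] at h2
      linarith)) M.pos_center (by simpa using h1) k
    simpa [hx] using this

/-- Each letter of a word for w is replaced by the reflection in the parallel hyperplane through v₀.
This keeps the linear part and makes all factors fix v₀. -/
theorem exists_fixing_linear_eq (hM : M.IsSpecial) (w : M.weylGroup) :
    ∃ w₀ : M.weylGroup, w₀.1 (M.v 0) = M.v 0 ∧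
      w₀.1.linearIsometryEquiv = w.1.linearIsometryEquiv := by
  obtain ⟨L, hL, rfl⟩ := exists_word w
  induction L with
  | nil => exact ⟨1, rfl, rfl⟩
  | cons s L ih =>
    obtain ⟨w₀, h0, h1⟩ := ih hL.tail
    obtain ⟨j, hs⟩ := hL.head
    obtain ⟨g, hg, hfix⟩ := exists_parallel hM hs 1
    have hα : (M.pull (M.coord j) 1⁻¹).linear = (M.coord j).linear := rfl
    rw [hα] at hfix
    have hg0 : g.1 (M.v 0) = M.v 0 := hfix _ (by simp)
    have hgs : g.1.linearIsometryEquiv = s.1.linearIsometryEquiv := by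
      obtain ⟨n, hn⟩ := LinearIsometryEquiv.apply_eq_of_fixes_ker (M.coord j).linear
      ext1 x
      rw [hn s.1.linearIsometryEquiv
        (fun x hx => by rw [hs.linear_apply, hx, zero_smul, add_zero]) hs.exists_linear_ne]
      refine hn g.1.linearIsometryEquiv (fun x hx => ?_) ?_ x
      · rw [CoxeterSimplex.linear_apply g.1 x (M.v 0), hg0, hfix _ (by simpa using hx),
          add_sub_cancel_right]
      · by_contra! hall
        refine hg (Subtype.ext (eq_of_linear_eq (p := M.v 0) ?_ hg0))
        ext1 x
        rw [hall]; rfl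
    refine ⟨g * w₀, ?_, ?_⟩
    · change g.1 (w₀.1 (M.v 0)) = _
      rw [h0, hg0]
    · ext1 x
      change g.1.linearIsometryEquiv (w₀.1.linearIsometryEquiv x) =
        s.1.linearIsometryEquiv (L.prod.1.linearIsometryEquiv x)
      rw [hgs, h1]

variable (M) in
/-- `t` is the translation by `l`. -/
def IsTranslation (t : M.weylGroup) (l : EuclideanSpace ℝ (Fin d)) : Prop := ∀ x, t.1 x = x + l

theorem IsTranslation.inv {t : M.weylGroup} {l : EuclideanSpace ℝ (Fin d)}
    (h : M.IsTranslation t l) : M.IsTranslation t⁻¹ (-l) := fun x => by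
  have h1 := M.inv_apply_self t (x + -l)
  rw [h, neg_add_cancel_right] at h1
  exact h1

theorem IsTranslation.mul {t t' : M.weylGroup} {l l' : EuclideanSpace ℝ (Fin d)}
    (h : M.IsTranslation t l) (h' : M.IsTranslation t' l') :
    M.IsTranslation (t * t') (l + l') := fun x => by
  change t.1 (t'.1 x) = _
  rw [h, h']; abel

/-- If w₀ fixes v₀ and has the linear part of w, then w w₀⁻¹ is the translation by w v₀ - v₀. In
particular Λ₀ is closed under addition and negation. -/
theorem mem_typeZeroLattice_iff (hM : M.IsSpecial) {l : EuclideanSpace ℝ (Fin d)} :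
    l ∈ M.typeZeroLattice ↔ ∃ t, M.IsTranslation t l := by
  constructor
  · rintro ⟨w, hw, rfl⟩
    obtain ⟨w₀, h0, h1⟩ := exists_fixing_linear_eq hM ⟨w, hw⟩
    refine ⟨⟨w, hw⟩ * w₀⁻¹, fun x => ?_⟩
    change w ((w₀⁻¹).1 x) = _
    have h2 := CoxeterSimplex.linear_apply w ((w₀⁻¹).1 x - M.v 0) (M.v 0)
    have h3 := CoxeterSimplex.linear_apply w₀.1 ((w₀⁻¹).1 x - M.v 0) (M.v 0)
    rw [h1, sub_add_cancel, apply_inv_self, h0] at h3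
    simp only at h3
    rw [h3, sub_add_cancel] at h2
    rw [eq_sub_iff_add_eq] at h2
    rw [← h2]; abel
  · rintro ⟨t, ht⟩
    exact ⟨t.1, t.2, by rw [ht]; abel⟩

/-! ### The cone at v₀ and dominant translations. -/

theorem mem_cone {x : EuclideanSpace ℝ (Fin d)} :
    x ∈ M.cone ↔ ∀ j, j ≠ 0 → 0 < M.coord j x := by
  have key : ∀ (t : ℝ) (y : EuclideanSpace ℝ (Fin d)) (j : Fin (d + 1)),
      M.coord j (M.v 0 + t • (y - M.v 0)) =
        M.coord j (M.v 0) + t * (M.coord j y - M.coord j (M.v 0)) := by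
    intro t y j
    have h1 := (M.coord j).map_vadd (M.v 0) (t • (y - M.v 0))
    have h2 : (M.coord j).linear (y - M.v 0) = M.coord j y - M.coord j (M.v 0) :=
      (M.coord j).linearMap_vsub y (M.v 0)
    rw [map_smul, h2, vadd_eq_add, vadd_eq_add, add_comm] at h1
    rw [h1, smul_eq_mul]; ring
  constructor
  · rintro ⟨t, ht, y, hy, rfl⟩ j hj
    rw [M.mem_interior] at hy
    rw [key, M.coord_ne hj.symm, sub_zero, zero_add]
    exact mul_pos ht (hy j)
  · intro h
    -- Shrinking towards v₀ by t changes the 0-th coordinate to 1 + (coord - 1)/t, which is positive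
    -- as soon as t exceeds |coord - 1|.
    set t : ℝ := |M.coord 0 x - 1| + 1 with ht
    have ht0 : 0 < t := by positivity
    refine ⟨t, ht0, M.v 0 + t⁻¹ • (x - M.v 0), M.mem_interior.2 fun j => ?_, ?_⟩
    · rw [key]
      by_cases hj : j = 0
      · subst hj
        rw [M.coord_self]
        have h1 : -|M.coord 0 x - 1| ≤ M.coord 0 x - 1 := neg_abs_le _
        have h2 : -1 < t⁻¹ * (M.coord 0 x - 1) := by
          rw [inv_mul_eq_div, lt_div_iff₀ ht0]; linarith
        linarith
      · rw [M.coord_ne (Ne.symm hj), sub_zero, zero_add]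
        exact mul_pos (inv_pos.2 ht0) (h j hj)
    · rw [add_sub_cancel_left, smul_smul, mul_inv_cancel₀ ht0.ne', one_smul]
      abel

variable (M) in
/-- `l` lies in the closed cone spanned by the simplex with apex `v₀`. -/
def IsDominant (l : EuclideanSpace ℝ (Fin d)) : Prop :=
  ∀ α : EuclideanSpace ℝ (Fin d) →ₗ[ℝ] ℝ, (∀ k, 0 ≤ α (M.v k - M.v 0)) → 0 ≤ α l

theorem isDominant_latticeVec {r : Fin d → ℚ} (hr : ∀ j, 0 < r j) (k : Fin d →₀ ℕ) :
    M.IsDominant (M.latticeVec r k) := by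
  intro α hα
  rw [latticeVec, map_sum]
  refine Finset.sum_nonneg fun j _ => ?_
  rw [map_nsmul, basisVec, map_smul]
  have : (0 : ℝ) ≤ r j := by exact_mod_cast (hr j).le
  exact nsmul_nonneg (mul_nonneg this (hα _)) _

theorem linear_coord_nonneg {j : Fin (d + 1)} (hj : j ≠ 0) (k : Fin (d + 1)) :
    0 ≤ (M.coord j).linear (M.v k - M.v 0) := by
  have h2 : (M.coord j).linear (M.v k - M.v 0) = M.coord j (M.v k) - M.coord j (M.v 0) :=
    (M.coord j).linearMap_vsub _ _
  rw [h2, M.coord_ne hj.symm, sub_zero]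
  by_cases hk : k = j
  · rw [hk, M.coord_self]; norm_num
  · rw [M.coord_ne hk]

/-- The only Weyl group element taking `v₀` to the same point as a dominant translation and the
cone into itself is this translation. -/
theorem eq_translation_of_cone {t w : M.weylGroup} {l : EuclideanSpace ℝ (Fin d)}
    (ht : M.IsTranslation t l) (hw : w.1 (M.v 0) = M.v 0 + l) (hcone : w.1 '' M.cone ⊆ M.cone) :
    w = t := by
  set L := w.1.linearIsometryEquiv
  have hval : ∀ x, w.1 (M.v 0 + x) = M.v 0 + l + L x := fun x => by
    have := CoxeterSimplex.linear_apply w.1 x (M.v 0)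
    rw [hw, add_comm x] at this
    change _ = _ + w.1.linearIsometryEquiv x
    rw [this]; abel
  have hadd : ∀ j x y, M.coord j (x + y) = (M.coord j).linear y + M.coord j x := fun j x y => by
    have := (M.coord j).map_vadd x y
    rw [vadd_eq_add, vadd_eq_add] at this
    rw [← this, add_comm]
  -- the linear part maps the cone into its closure
  have hlin : ∀ j, j ≠ 0 → ∀ x, M.v 0 + x ∈ M.cone → 0 ≤ (M.coord j).linear (L x) := by
    intro j hj x hx
    by_contra! hneg
    have hall : ∀ a : ℝ, 0 < a → 0 < a * (M.coord j).linear (L x) + (M.coord j).linear l := by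
      intro a ha
      have h1 : M.v 0 + a • x ∈ M.cone := mem_cone.2 fun i hi => by
        have h2 := mem_cone.1 hx i hi
        rw [hadd, M.coord_ne hi.symm, add_zero] at h2 ⊢
        rw [map_smul]
        exact mul_pos ha h2
      have h3 := mem_cone.1 (hcone ⟨_, h1, rfl⟩) j hj
      rw [hval, hadd, hadd, M.coord_ne hj.symm, map_smul, map_smul, add_zero] at h3
      exact h3
    set b := (M.coord j).linear (L x) with hb
    set c := (M.coord j).linear l with hc
    -- This factor makes the leading term -(|c| + 1), which c cannot compensate.
    have h4 := hall ((|c| + 1) / -b) (div_pos (by positivity) (by linarith))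
    have h5 : (|c| + 1) / -b * b = -(|c| + 1) := by
      have : b ≠ 0 := hneg.ne
      field_simp
    rw [h5] at h4
    linarith [le_abs_self c]
  -- So far images are only known to lie in the closed cone. The barycenter may be moved slightly
  -- against y, where L y = v_j - v₀ has j-th coordinate 1, without leaving the open cone; this
  -- gives a strict inequality.
  have hstrict : M.v 0 + L (M.center - M.v 0) ∈ M.cone := by
    refine mem_cone.2 fun j hj => ?_
    rw [hadd, M.coord_ne hj.symm, add_zero]
    set y := L.symm (M.v j - M.v 0)
    have hy : (M.coord j).linear (L y) = 1 := by
      rw [L.apply_symm_apply]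
      have h2 : (M.coord j).linear (M.v j - M.v 0) = M.coord j (M.v j) - M.coord j (M.v 0) :=
        (M.coord j).linearMap_vsub _ _
      rw [h2, M.coord_self, M.coord_ne hj.symm, sub_zero]
    have hev : ∀ᶠ a in nhds (0 : ℝ), M.center - a • y ∈
        interior (convexHull ℝ (Set.range M.v)) := by
      have hc : Continuous fun a : ℝ => M.center - a • y := by fun_prop
      refine hc.continuousAt.eventually_mem (isOpen_interior.mem_nhds ?_)
      simpa using M.mem_interior.2 M.pos_center
    obtain ⟨a, ha, ha0⟩ := (hev.filter_mono nhdsWithin_le_nhds |>.and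
      (self_mem_nhdsWithin (s := Set.Ioi (0 : ℝ)))).exists
    have h6 := hlin j hj (M.center - M.v 0 - a • y) (by
      have : M.v 0 + (M.center - M.v 0 - a • y) = M.center - a • y := by abel
      rw [this]
      exact mem_cone.2 fun i _ => M.mem_interior.1 ha i)
    rw [map_sub, map_sub, map_smul, map_smul, hy, smul_eq_mul, mul_one] at h6
    have : (0 : ℝ) < a := ha0
    linarith
  obtain ⟨b, hb, y, hy, he⟩ := hstrict
  rw [add_right_inj] at he
  rw [M.mem_interior] at hy
  -- compare the images of a small homothetic copy
  have hhom : ∀ {p : EuclideanSpace ℝ (Fin d)} {a : ℝ}, M.Pos p → 0 < a → a ≤ 1 →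
      M.Pos (M.v 0 + a • (p - M.v 0)) := by
    intro p a hp ha ha1 j
    have h2 : (M.coord j).linear (p - M.v 0) = M.coord j p - M.coord j (M.v 0) :=
      (M.coord j).linearMap_vsub _ _
    rw [hadd, map_smul, h2, smul_eq_mul]
    have h3 := mul_pos ha (hp j)
    by_cases hj : j = 0
    · subst hj
      rw [M.coord_self]; linarith
    · rw [M.coord_ne (Ne.symm hj)]; linarith
  -- With a ≤ 1 the shrunken barycenter is in the open simplex, and with a b ≤ 1 so is its image
  -- under t⁻¹ w. Freeness then gives t⁻¹ w = 1.
  set a : ℝ := min 1 b⁻¹ with ha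
  have ha0 : 0 < a := lt_min one_pos (inv_pos.2 hb)
  have hab : a * b ≤ 1 := by
    have : a ≤ b⁻¹ := min_le_right _ _
    calc a * b ≤ b⁻¹ * b := by gcongr
      _ = 1 := inv_mul_cancel₀ hb.ne'
  have hone : t⁻¹ * w = 1 := by
    refine M.eq_one_of_pos _ (hhom M.pos_center ha0 (min_le_left _ _)) ?_
    change M.Pos ((t⁻¹).1 (w.1 _))
    rw [ht.inv, hval, map_smul, he, smul_smul]
    have : M.v 0 + l + (a * b) • (y - M.v 0) + -l = M.v 0 + (a * b) • (y - M.v 0) := by abel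
    rw [this]
    exact hhom hy (mul_pos ha0 hb) hab
  exact (inv_mul_eq_one.1 hone).symm

theorem isPosition_iff {r : Fin d → ℚ} (hr : ∀ j, 0 < r j) {k : Fin d →₀ ℕ} {t : M.weylGroup}
    (ht : M.IsTranslation t (M.latticeVec r k)) (w : M.weylGroup) :
    M.IsPosition r k w ↔ w = t := by
  constructor
  · rintro ⟨h1, h2⟩
    exact eq_translation_of_cone ht h1 h2
  · rintro rfl
    refine ⟨ht _, ?_⟩
    rintro _ ⟨x, hx, rfl⟩
    refine mem_cone.2 fun j hj => ?_
    have h1 := mem_cone.1 hx j hj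
    have h2 := isDominant_latticeVec (M := M) hr k _ (linear_coord_nonneg hj)
    have h3 := (M.coord j).map_vadd x (M.latticeVec r k)
    rw [vadd_eq_add, vadd_eq_add, add_comm] at h3
    rw [ht, h3]
    linarith

/-! ### Words which are reduced over a given element -/

variable (M) in
/-- The length increases along the products of `u` with the beginnings of the word. -/
def IsReducedOver : M.weylGroup → List M.weylGroup → Prop
  | _, [] => True
  | u, s :: L => M.len u < M.len (u * s) ∧ IsReducedOver (u * s) L

/-- Let h define the wall crossed by the gallery of t' after the prefix p. It is positive at the
barycenter and negative at its translate by l', so its linear part is negative on l', hence by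
`linear_sign` nonpositive on l. Therefore h is still positive at the barycenter moved by -l, so the
same letter lengthens t p. -/
theorem isReducedOver_of_dominant (hM : M.IsSpecial) {t t' : M.weylGroup}
    {l l' : EuclideanSpace ℝ (Fin d)} (ht : M.IsTranslation t l) (ht' : M.IsTranslation t' l')
    (hl : M.IsDominant l) (hl' : M.IsDominant l') :
    ∀ (L : List M.weylGroup), M.IsWord L → ∀ p : M.weylGroup, p * L.prod = t' →
      M.len p + L.length = M.len t' → M.IsReducedOver (t * p) L
  | [], _, _, _, _ => trivial
  | s :: L, hL, p, hp, hlen => by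
    obtain ⟨j, hs⟩ := hL.head
    rw [List.length_cons] at hlen
    have hpL : p * s * L.prod = t' := by rw [← hp, List.prod_cons, mul_assoc]
    have h1 : M.len t' ≤ M.len (p * s) + L.length := by
      rw [← hpL]
      exact (len_mul_le _ _).trans (Nat.add_le_add_left (len_prod_le hL.tail) _)
    have h2 : M.len (p * s) ≤ M.len p + 1 :=
      (len_mul_le _ _).trans (Nat.add_le_add_left hs.len_le_one _)
    refine ⟨?_, ?_⟩
    · set h := M.pull (M.coord j) p⁻¹
      have hpos : 0 < h M.center := coord_pos_of_lt_len hs (by omega)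
      -- The whole word is reduced, so dropping its first letter shortens the remaining product;
      -- read on the inverse, this puts t' C₀ beyond the wall.
      have hneg : h (t'.1 M.center) < 0 := by
        have h3 : M.coord j (((s :: L).prod).1 M.center) < 0 := by
          have := coord_neg_of_len_lt hs (w := (s :: L).prod⁻¹) (by
            rw [← len_inv, len_inv (s :: L).prod, mul_inv_rev, inv_inv, hs.inv_eq,
              List.prod_cons, ← mul_assoc, hs.mul_self, one_mul]
            have h4 := len_prod_le hL.tail
            have h5 := len_mul_le p (s :: L).prod
            rw [hp, List.prod_cons] at h5
            omega)
          rwa [inv_inv] at this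
        rw [← hp, pull_apply]
        change M.coord j ((p⁻¹).1 (p.1 (((s :: L).prod).1 M.center))) < 0
        rwa [inv_apply_self]
      have hadd : ∀ x y, h (x + y) = h.linear y + h x := fun x y => by
        have := h.map_vadd x y
        rw [vadd_eq_add, vadd_eq_add] at this
        rw [← this, add_comm]
      rw [ht', hadd] at hneg
      apply lt_len_mul hs
      rw [mul_inv_rev]
      change 0 < h ((t⁻¹).1 M.center)
      rw [ht.inv, hadd, map_neg]
      rcases linear_sign hM hs p with h6 | h6
      · have : 0 ≤ h.linear l' := hl' _ h6
        linarith
      · have : 0 ≤ -(h.linear l) := hl _ h6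
        linarith
    · rw [mul_assoc]
      exact isReducedOver_of_dominant hM ht ht' hl hl' L hL.tail (p * s) hpL (by omega)

theorem exists_reducedOver (hM : M.IsSpecial) {t t' : M.weylGroup}
    {l l' : EuclideanSpace ℝ (Fin d)} (ht : M.IsTranslation t l) (ht' : M.IsTranslation t' l')
    (hl : M.IsDominant l) (hl' : M.IsDominant l') :
    ∃ L, M.IsWord L ∧ L.prod = t' ∧ M.IsReducedOver t L := by
  obtain ⟨L, hL, hw, hlen⟩ := exists_reduced_word t'
  have h1 : M.len (1 : M.weylGroup) = 0 := Nat.le_zero.1 (len_prod_le (M := M) IsWord.nil)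
  have := isReducedOver_of_dominant hM ht ht' hl hl' L hL 1 (by rw [one_mul, hw])
    (by rw [h1, hlen, zero_add])
  exact ⟨L, hL, hw, by rwa [mul_one] at this⟩

end CoxeterSimplex

namespace CoxeterSimplex

variable {d : ℕ} (M : CoxeterSimplex d)

/-! ### The Coxeter complex -/

theorem vertex_eq_iff {w u : M.weylGroup} {i j : Fin (d + 1)} :
    M.vertex w i = M.vertex u j ↔ w.1 (M.v i) = u.1 (M.v j) := Subtype.ext_iff

theorem vertex_injective (w : M.weylGroup) : Function.Injective (M.vertex w) := fun i j h => by
  rw [vertex_eq_iff] at h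
  exact M.indep.injective (w.1.injective h)

/-- The vertex set of the chamber `w C₀`. -/
def chamber (w : M.weylGroup) : Finset M.Vertex :=
  Finset.univ.map ⟨M.vertex w, M.vertex_injective w⟩

variable {M}

theorem mem_chamber {w : M.weylGroup} {x : M.Vertex} :
    x ∈ M.chamber w ↔ ∃ j, M.vertex w j = x := by
  simp [chamber]

theorem card_chamber (w : M.weylGroup) : (M.chamber w).card = d + 1 := by simp [chamber]

theorem mem_faces {s : Finset M.Vertex} :
    s ∈ M.faces ↔ s.Nonempty ∧ ∃ w, s ⊆ M.chamber w := by
  simp only [faces, Set.mem_ofPred_eq, Finset.subset_iff, mem_chamber, eq_comm]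

theorem chamber_mem_faces (w : M.weylGroup) : M.chamber w ∈ M.faces :=
  mem_faces.2 ⟨⟨_, mem_chamber.2 ⟨0, rfl⟩⟩, w, subset_rfl⟩

theorem exists_eq_vertex (x : M.Vertex) : ∃ w j, M.vertex w j = x := by
  obtain ⟨x, w, hw, j, rfl⟩ := x
  exact ⟨⟨w, hw⟩, j, rfl⟩

theorem singleton_mem_faces (x : M.Vertex) : {x} ∈ M.faces := by
  obtain ⟨w, j, rfl⟩ := exists_eq_vertex x
  exact mem_faces.2 ⟨by simp, w, by simpa using mem_chamber.2 ⟨j, rfl⟩⟩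

variable (M) in
/-- The action of a Weyl group element on the vertices. -/
def vertexMap (u : M.weylGroup) : M.Vertex ↪ M.Vertex where
  toFun x := ⟨u.1 x.1, by
    obtain ⟨w, hw, j, h⟩ := x.2
    exact ⟨u.1 * w, mul_mem u.2 hw, j, by rw [← h]; rfl⟩⟩
  inj' x y h := Subtype.ext (u.1.injective (congrArg Subtype.val h))

theorem vertexMap_vertex (u w : M.weylGroup) (j : Fin (d + 1)) :
    M.vertexMap u (M.vertex w j) = M.vertex (u * w) j := rfl

theorem map_vertexMap_mem_faces (u : M.weylGroup) {s : Finset M.Vertex} (hs : s ∈ M.faces) :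
    s.map (M.vertexMap u) ∈ M.faces := by
  obtain ⟨h1, w, h2⟩ := mem_faces.1 hs
  refine mem_faces.2 ⟨h1.map, u * w, fun x hx => ?_⟩
  obtain ⟨y, hy, rfl⟩ := Finset.mem_map.1 hx
  obtain ⟨j, rfl⟩ := mem_chamber.1 (h2 hy)
  exact mem_chamber.2 ⟨j, rfl⟩

theorem IsIsoOnto.comp_vertexMap {V : Type*} {φ : M.Vertex ↪ V} {a : Set (Finset V)}
    (h : M.IsIsoOnto φ a) (u : M.weylGroup) : M.IsIsoOnto ((M.vertexMap u).trans φ) a := by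
  unfold IsIsoOnto at h ⊢
  rw [h]
  ext t
  constructor
  · rintro ⟨s, hs, rfl⟩
    refine ⟨s.map (M.vertexMap u⁻¹), map_vertexMap_mem_faces _ hs, ?_⟩
    simp only
    rw [Finset.map_map, ← Function.Embedding.trans_assoc]
    have : (M.vertexMap u⁻¹).trans (M.vertexMap u) = Function.Embedding.refl _ := by
      ext x
      exact Subtype.ext (M.apply_inv_self u x.1)
    rw [this]
    rfl
  · rintro ⟨s, hs, rfl⟩
    exact ⟨_, map_vertexMap_mem_faces u hs, by simp only [Finset.map_map]⟩

theorem IsIsoOnto.exists_eq_chamber {V : Type*} {φ : M.Vertex ↪ V} {a : Set (Finset V)}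
    (h : M.IsIsoOnto φ a) {c : Finset V} (hc : c ∈ a) (hcard : c.card = d + 1) :
    ∃ w, c = (M.chamber w).map φ := by
  rw [h] at hc
  obtain ⟨s, hs, rfl⟩ := hc
  obtain ⟨-, w, hw⟩ := mem_faces.1 hs
  refine ⟨w, ?_⟩
  simp only [Finset.card_map] at hcard
  rw [Finset.eq_of_subset_of_card_le hw (by rw [card_chamber, hcard])]

theorem IsIsoOnto.chamber_mem {V : Type*} {φ : M.Vertex ↪ V} {a : Set (Finset V)}
    (h : M.IsIsoOnto φ a) (w : M.weylGroup) : (M.chamber w).map φ ∈ a := by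
  rw [h]; exact ⟨_, chamber_mem_faces w, rfl⟩

theorem IsIsoOnto.exists_apply_eq {V : Type*} {φ ψ : M.Vertex ↪ V} {a : Set (Finset V)}
    (hφ : M.IsIsoOnto φ a) (hψ : M.IsIsoOnto ψ a) (x : M.Vertex) : ∃ y, ψ y = φ x := by
  have h : Finset.map φ {x} ∈ a := by rw [hφ]; exact ⟨_, singleton_mem_faces x, rfl⟩
  rw [hψ] at h
  obtain ⟨s, -, hs⟩ := h
  have : φ x ∈ Finset.map φ {x} := by simp
  rw [← hs] at this
  obtain ⟨y, -, hy⟩ := Finset.mem_map.1 this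
  exact ⟨y, hy⟩

/-- A Weyl group element preserving all vertices of the simplex but one is trivial or the
reflection along the opposite wall. -/
theorem eq_or_isWall {w z : M.weylGroup} {j : Fin (d + 1)}
    (h : ∀ i, i ≠ j → w.1 (M.v i) = z.1 (M.v i)) : z = w ∨ M.IsWall j (w⁻¹ * z) := by
  by_cases h1 : w⁻¹ * z = 1
  · exact Or.inl (inv_mul_eq_one.1 h1).symm
  · refine Or.inr ⟨h1, fun i hi => ?_⟩
    change (w⁻¹).1 (z.1 (M.v i)) = _
    rw [← h i hi, inv_apply_self]

theorem IsWall.vertex_eq {j : Fin (d + 1)} {s : M.weylGroup} (hs : M.IsWall j s)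
    (w : M.weylGroup) {i : Fin (d + 1)} (hi : i ≠ j) : M.vertex (w * s) i = M.vertex w i :=
  M.vertex_eq_iff.2 (congrArg w.1 (hs.2 i hi))

end CoxeterSimplex

namespace AffineBuilding

open CoxeterSimplex

variable {d : ℕ} {M : CoxeterSimplex d} {V : Type*} (X : AffineBuilding M V)

/-! ### Charts and rigidity -/

/-- A type-preserving isomorphism from the Coxeter complex onto an apartment. -/
structure IsChart (a : Set (Finset V)) (φ : M.Vertex ↪ V) : Prop where
  mem : a ∈ X.apartments
  iso : M.IsIsoOnto φ a
  lab : ∀ w j, X.lab (φ (M.vertex w j)) = j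

variable {X}

theorem IsChart.comp_vertexMap {a : Set (Finset V)} {φ : M.Vertex ↪ V} (h : X.IsChart a φ)
    (u : M.weylGroup) : X.IsChart a ((M.vertexMap u).trans φ) :=
  ⟨h.mem, h.iso.comp_vertexMap u, fun w j => h.lab (u * w) j⟩

theorem exists_isChart {a : Set (Finset V)} (h : a ∈ X.apartments) : ∃ φ, X.IsChart a φ := by
  obtain ⟨φ, h1, h2⟩ := X.exists_chart a h
  exact ⟨φ, h, h1, h2⟩

/-- An isomorphism onto an apartment which agrees with a chart on a chamber is this chart. -/
theorem IsChart.eq_of_iso {b : Set (Finset V)} {φ ψ : M.Vertex ↪ V} (hφ : X.IsChart b φ)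
    (hψ : M.IsIsoOnto ψ b) (h1 : ∀ j, ψ (M.vertex 1 j) = φ (M.vertex 1 j)) : ψ = φ := by
  have key : ∀ L : List M.weylGroup, M.IsWord L → ∀ w : M.weylGroup,
      (∀ j, ψ (M.vertex w j) = φ (M.vertex w j)) →
      ∀ j, ψ (M.vertex (w * L.prod) j) = φ (M.vertex (w * L.prod) j) := by
    intro L
    induction L with
    | nil => intro _ w hw; simpa using hw
    | cons s L ih =>
      intro hL w hw
      obtain ⟨j, hs⟩ := hL.head
      rw [List.prod_cons, ← mul_assoc]
      refine ih hL.tail (w * s) fun i => ?_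
      by_cases hi : i ≠ j
      · rw [hs.vertex_eq w hi, hw]
      rw [not_not] at hi
      subst hi
      -- No hypothesis makes ψ type-preserving, so its image of w s C₀ is first located as the
      -- φ-image of some z C₀. The labels of φ force z C₀ to share with w C₀ all vertices but the
      -- i-th, so z is w or w s; injectivity of ψ excludes z = w.
      obtain ⟨z, hz⟩ := hφ.iso.exists_eq_chamber (hψ.chamber_mem (w * s))
        (by rw [Finset.card_map, card_chamber])
      have hmem : ∀ k, ∃ m, φ (M.vertex z m) = ψ (M.vertex (w * s) k) := by
        intro k
        have : ψ (M.vertex (w * s) k) ∈ (M.chamber (w * s)).map ψ :=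
          Finset.mem_map_of_mem _ (mem_chamber.2 ⟨k, rfl⟩)
        rw [hz] at this
        obtain ⟨y, hy, he⟩ := Finset.mem_map.1 this
        obtain ⟨m, rfl⟩ := mem_chamber.1 hy
        exact ⟨m, he⟩
      have hzw : ∀ k, k ≠ i → M.vertex z k = M.vertex w k := by
        intro k hk
        obtain ⟨m, hm⟩ := hmem k
        rw [hs.vertex_eq w hk, hw] at hm
        have := hφ.lab z m
        rw [hm, hφ.lab] at this
        subst this
        exact φ.injective hm
      obtain ⟨m, hm⟩ := hmem i
      have hmi : m = i := by
        by_contra hne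
        rw [hzw m hne, ← hw, ← hs.vertex_eq w hne] at hm
        exact hne (M.vertex_injective _ (ψ.injective hm))
      subst hmi
      rcases eq_or_isWall (w := w) (z := z) (j := m)
        (fun k hk => (M.vertex_eq_iff.1 (hzw k hk)).symm) with h | h
      · subst h
        rw [← hw] at hm
        have h3 := M.vertex_eq_iff.1 (ψ.injective hm)
        exact absurd (M.eq_one_of_fixes s fun k => by
          by_cases hk : k = m
          · subst hk
            exact (z.1.injective h3).symm
          · exact hs.2 k hk) hs.1
      · have := h.unique hs
        rw [← hm, ← this, mul_inv_cancel_left]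
  ext x
  obtain ⟨w, j, rfl⟩ := exists_eq_vertex x
  obtain ⟨L, hL, rfl⟩ := exists_word w
  have := key L hL 1 h1 j
  rwa [one_mul] at this

/-- Charts which agree on a chamber agree on all common simplices of the two apartments. -/
theorem IsChart.agree {a b : Set (Finset V)} {φ φ' : M.Vertex ↪ V} (hφ : X.IsChart a φ)
    (hφ' : X.IsChart b φ') (h1 : ∀ j, φ' (M.vertex 1 j) = φ (M.vertex 1 j)) {s : Finset V}
    (hsa : s ∈ a) (hsb : s ∈ b) {x : M.Vertex} (hx : φ x ∈ s) : φ' x = φ x := by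
  have hc : (M.chamber 1).map φ ∈ b := by
    have : (M.chamber 1).map φ = (M.chamber 1).map φ' := by
      ext y
      simp only [Finset.mem_map, mem_chamber, exists_exists_eq_and, h1]
    rw [this]
    exact hφ'.iso.chamber_mem 1
  obtain ⟨φ₀, ψ₀, hφ₀, hψ₀, hag⟩ := X.exists_iso a hφ.mem b hφ'.mem _
    ⟨hφ.iso.chamber_mem 1, hc⟩ s ⟨hsa, hsb⟩ (by rw [Finset.card_map, card_chamber])
  -- The isomorphisms φ₀, ψ₀ of the building axiom need not be the given charts. With σ = φ₀⁻¹ φ,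
  -- the map ψ₀ σ is an isomorphism onto b agreeing with φ' on the base chamber, so it equals φ'.
  choose σ hσ using hφ.iso.exists_apply_eq hφ₀
  let σ' : M.Vertex ↪ M.Vertex := ⟨σ, fun x y h => φ.injective (by rw [← hσ, ← hσ, h])⟩
  have hcomp : σ'.trans φ₀ = φ := by ext x; exact hσ x
  have himg : (fun s => s.map σ') '' M.faces = M.faces := by
    have h2 : (fun s => s.map φ₀) '' ((fun s => s.map σ') '' M.faces) =
        (fun s => s.map φ₀) '' M.faces := by
      rw [Set.image_image, ← hφ₀, hφ.iso]
      simp only [Finset.map_map, hcomp]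
    exact (Set.image_injective.2 (Finset.map_injective φ₀)) h2
  have hψ : M.IsIsoOnto (σ'.trans ψ₀) b := by
    unfold IsIsoOnto
    rw [hψ₀]
    conv_lhs => rw [← himg]
    rw [Set.image_image]
    simp only [Finset.map_map]
  have heq := hφ'.eq_of_iso hψ fun j => by
    change ψ₀ (σ _) = _
    rw [hag, hσ, h1]
    left
    rw [hσ]
    exact Finset.mem_map_of_mem _ (mem_chamber.2 ⟨j, rfl⟩)
  rw [← heq]
  change ψ₀ (σ x) = _
  rw [hag, hσ]
  right
  rwa [hσ]

/-! ### The Weyl distance -/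

theorem Chamber.exists_isChart (c : X.Chamber) :
    ∃ a φ, X.IsChart a φ ∧ c.1 ∈ a := by
  obtain ⟨a, ha, hc⟩ : c.1 ∈ ⋃₀ X.apartments := X.union_apartments ▸ c.2.1
  obtain ⟨φ, hφ⟩ := AffineBuilding.exists_isChart ha
  exact ⟨a, φ, hφ, hc⟩

theorem IsChart.exists_coe_eq {a : Set (Finset V)} {φ : M.Vertex ↪ V} (hφ : X.IsChart a φ)
    {c : X.Chamber} (hc : c.1 ∈ a) : ∃ w, (c.1 : Set V) = Set.range fun j => φ (M.vertex w j) := by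
  obtain ⟨w, hw⟩ := hφ.iso.exists_eq_chamber hc c.2.2
  refine ⟨w, ?_⟩
  rw [hw]
  ext x
  simp [mem_chamber]

theorem Chamber.exists_lab_eq (c : X.Chamber) (j : Fin (d + 1)) : ∃ x ∈ c.1, X.lab x = j := by
  obtain ⟨a, φ, hφ, hc⟩ := c.exists_isChart
  obtain ⟨w, hw⟩ := hφ.exists_coe_eq hc
  refine ⟨φ (M.vertex w j), ?_, hφ.lab w j⟩
  rw [← Finset.mem_coe, hw]
  exact ⟨j, rfl⟩

/-- The vertex of type `j` of a chamber. -/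
def Chamber.pt (c : X.Chamber) (j : Fin (d + 1)) : V := (c.exists_lab_eq j).choose

theorem Chamber.pt_mem (c : X.Chamber) (j : Fin (d + 1)) : c.pt j ∈ c.1 :=
  (c.exists_lab_eq j).choose_spec.1

theorem Chamber.lab_pt (c : X.Chamber) (j : Fin (d + 1)) : X.lab (c.pt j) = j :=
  (c.exists_lab_eq j).choose_spec.2

theorem Chamber.pt_injective (c : X.Chamber) : Function.Injective c.pt := fun i j h => by
  rw [← c.lab_pt i, h, c.lab_pt]

theorem Chamber.coe_eq (c : X.Chamber) : (c.1 : Set V) = Set.range c.pt := by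
  have h : Finset.univ.map ⟨c.pt, c.pt_injective⟩ = c.1 := by
    refine Finset.eq_of_subset_of_card_le (fun x hx => ?_) (by rw [c.2.2]; simp)
    obtain ⟨j, -, rfl⟩ := Finset.mem_map.1 hx
    exact c.pt_mem j
  rw [← h]
  simp

theorem Chamber.ext_pt {c c' : X.Chamber} (h : ∀ j, c.pt j = c'.pt j) : c = c' := by
  apply Subtype.ext
  rw [← Finset.coe_inj, c.coe_eq, c'.coe_eq, funext h]

theorem IsChart.coe_eq_iff {a : Set (Finset V)} {φ : M.Vertex ↪ V} (hφ : X.IsChart a φ)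
    (c : X.Chamber) (w : M.weylGroup) :
    ((c.1 : Set V) = Set.range fun j => φ (M.vertex w j)) ↔ ∀ j, φ (M.vertex w j) = c.pt j := by
  constructor
  · intro h j
    have h1 : c.pt j ∈ (c.1 : Set V) := c.pt_mem j
    rw [h] at h1
    obtain ⟨i, hi⟩ := h1
    have h2 := c.lab_pt j
    rw [← hi, hφ.lab] at h2
    rw [← hi, h2]
  · intro h
    rw [c.coe_eq]
    simp only [h]

variable (X) in
/-- The chamber `c'` has Weyl distance `w` from `c`. -/
def Rel (w : M.weylGroup) (c c' : X.Chamber) : Prop :=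
  ∃ a φ, X.IsChart a φ ∧ (∀ j, φ (M.vertex 1 j) = c.pt j) ∧ ∀ j, φ (M.vertex w j) = c'.pt j

theorem IsChart.rel {a : Set (Finset V)} {φ : M.Vertex ↪ V} (hφ : X.IsChart a φ)
    {c c' : X.Chamber} {u w : M.weylGroup} (hc : ∀ j, φ (M.vertex u j) = c.pt j)
    (hc' : ∀ j, φ (M.vertex w j) = c'.pt j) : X.Rel (u⁻¹ * w) c c' :=
  ⟨a, _, hφ.comp_vertexMap u, fun j => by
    rw [Function.Embedding.trans_apply, vertexMap_vertex, mul_one, hc], fun j => by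
    rw [Function.Embedding.trans_apply, vertexMap_vertex, mul_inv_cancel_left, hc']⟩

/-- The chamber at `w` of a chart. -/
def IsChart.chamberAt {a : Set (Finset V)} {φ : M.Vertex ↪ V} (hφ : X.IsChart a φ)
    (w : M.weylGroup) : X.Chamber :=
  ⟨(M.chamber w).map φ, by
    rw [X.union_apartments]
    exact ⟨a, hφ.mem, hφ.iso.chamber_mem w⟩, by rw [Finset.card_map, card_chamber]⟩

theorem IsChart.apply_vertex {a : Set (Finset V)} {φ : M.Vertex ↪ V} (hφ : X.IsChart a φ)
    (w : M.weylGroup) (j : Fin (d + 1)) : φ (M.vertex w j) = (hφ.chamberAt w).pt j := by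
  refine (hφ.coe_eq_iff _ w).1 ?_ j
  ext x
  simp [chamberAt, mem_chamber]

theorem exists_rel (c c' : X.Chamber) : ∃ w, X.Rel w c c' := by
  obtain ⟨a, ha, hc, hc'⟩ := X.exists_apartment c.1 c.2.1 c'.1 c'.2.1 c.2.2 c'.2.2
  obtain ⟨φ, hφ⟩ := AffineBuilding.exists_isChart ha
  obtain ⟨u, hu⟩ := hφ.exists_coe_eq hc
  obtain ⟨w, hw⟩ := hφ.exists_coe_eq hc'
  exact ⟨_, hφ.rel ((hφ.coe_eq_iff _ _).1 hu) ((hφ.coe_eq_iff _ _).1 hw)⟩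

theorem Rel.inv {w : M.weylGroup} {c c' : X.Chamber} (h : X.Rel w c c') : X.Rel w⁻¹ c' c := by
  obtain ⟨a, φ, hφ, h1, h2⟩ := h
  have := hφ.rel h2 h1
  rwa [mul_one] at this

/-- The intermediate chamber is taken inside an apartment containing both ends. -/
theorem Rel.exists_between {u w : M.weylGroup} {c c' : X.Chamber} (h : X.Rel (u * w) c c') :
    ∃ e, X.Rel u c e ∧ X.Rel w e c' := by
  obtain ⟨a, φ, hφ, h1, h2⟩ := h
  refine ⟨hφ.chamberAt u, ⟨a, φ, hφ, h1, hφ.apply_vertex u⟩, ?_⟩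
  have := hφ.rel (hφ.apply_vertex u) h2
  rwa [inv_mul_cancel_left] at this

theorem rel_one_iff {c c' : X.Chamber} : X.Rel 1 c c' ↔ c = c' := by
  constructor
  · rintro ⟨a, φ, hφ, h1, h2⟩
    exact Chamber.ext_pt fun j => by rw [← h1, h2]
  · rintro rfl
    obtain ⟨a, φ, hφ, hc⟩ := c.exists_isChart
    obtain ⟨w, hw⟩ := hφ.exists_coe_eq hc
    have := hφ.rel ((hφ.coe_eq_iff _ _).1 hw) ((hφ.coe_eq_iff _ _).1 hw)
    rwa [inv_mul_cancel] at this

theorem IsChart.chamber_mem {a : Set (Finset V)} {φ : M.Vertex ↪ V} (hφ : X.IsChart a φ)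
    {c : X.Chamber} {w : M.weylGroup} (h : ∀ j, φ (M.vertex w j) = c.pt j) : c.1 ∈ a := by
  have : c = hφ.chamberAt w := Chamber.ext_pt fun j => by rw [← h, hφ.apply_vertex]
  rw [this]
  exact hφ.iso.chamber_mem w

/-- Two charts based at c agree on the common chamber c', so c' has the same position in both. -/
theorem Rel.unique {w w' : M.weylGroup} {c c' : X.Chamber} (h : X.Rel w c c')
    (h' : X.Rel w' c c') : w = w' := by
  obtain ⟨a, φ, hφ, h1, h2⟩ := h
  obtain ⟨b, φ', hφ', h1', h2'⟩ := h'
  refine M.eq_of_apply_eq fun j => ?_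
  rw [← M.vertex_eq_iff]
  apply φ'.injective
  rw [h2', ← h2]
  refine hφ.agree (s := c'.1) hφ' (fun j => by rw [h1, h1']) (hφ.chamber_mem h2)
    (hφ'.chamber_mem h2') ?_
  rw [h2]
  exact c'.pt_mem j

theorem Rel.pt_eq {j : Fin (d + 1)} {s : M.weylGroup} (hs : M.IsWall j s) {c c' : X.Chamber}
    (h : X.Rel s c c') {i : Fin (d + 1)} (hi : i ≠ j) : c.pt i = c'.pt i := by
  obtain ⟨a, φ, hφ, h1, h2⟩ := h
  rw [← h1, ← h2, ← hs.vertex_eq 1 hi, one_mul]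

theorem rel_of_pt_eq {j : Fin (d + 1)} {s : M.weylGroup} (hs : M.IsWall j s) {c c' : X.Chamber}
    (h : ∀ i, i ≠ j → c.pt i = c'.pt i) (hne : c ≠ c') : X.Rel s c c' := by
  obtain ⟨z, hz⟩ := exists_rel c c'
  obtain ⟨a, φ, hφ, h1, h2⟩ := hz
  rcases eq_or_isWall (w := 1) (z := z) (j := j) (fun i hi => by
    rw [← M.vertex_eq_iff]
    apply φ.injective
    rw [h1, h2, h i hi]) with h3 | h3
  · subst h3
    exact absurd (rel_one_iff.1 ⟨a, φ, hφ, h1, h2⟩) hne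
  · rw [inv_one, one_mul] at h3
    rw [hs.unique h3]
    exact ⟨a, φ, hφ, h1, h2⟩

/-- The Weyl distance to adjacent chambers differs at most by the reflection. -/
theorem Rel.of_adjacent {j : Fin (d + 1)} {s w : M.weylGroup} (hs : M.IsWall j s)
    {c c' c'' : X.Chamber} (h : X.Rel w c c') (h' : X.Rel s c' c'') :
    X.Rel w c c'' ∨ X.Rel (w * s) c c'' := by
  obtain ⟨z, hz⟩ := exists_rel c c''
  have hz' := hz
  obtain ⟨a, φ, hφ, h1, h2⟩ := h
  obtain ⟨b, φ', hφ', h1', h2'⟩ := hz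
  obtain ⟨i₀, hi₀⟩ := hs.exists_index_ne
  -- The panel shared by c' and c''. The apartments of the two charts have c and p in common, so the
  -- charts agree on p and the positions of c' and c'' differ at most in the vertex j.
  set p : Finset V := (Finset.univ.erase j).map ⟨c'.pt, c'.pt_injective⟩ with hp
  have hmem : ∀ i, i ≠ j → c'.pt i ∈ p := fun i hi =>
    Finset.mem_map_of_mem ⟨c'.pt, c'.pt_injective⟩ (Finset.mem_erase.2 ⟨hi, Finset.mem_univ i⟩)
  have hsub : ∀ {a : Set (Finset V)} {φ : M.Vertex ↪ V} {e : X.Chamber} {u : M.weylGroup},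
      X.IsChart a φ → (∀ j, φ (M.vertex u j) = e.pt j) → (∀ i, i ≠ j → e.pt i = c'.pt i) →
      p ∈ a := by
    intro a φ e u hφ hu he
    rw [hφ.iso]
    refine ⟨(Finset.univ.erase j).map ⟨M.vertex u, M.vertex_injective u⟩,
      mem_faces.2 ⟨⟨M.vertex u i₀, ?_⟩, u, ?_⟩, ?_⟩
    · exact Finset.mem_map_of_mem ⟨M.vertex u, M.vertex_injective u⟩
        (Finset.mem_erase.2 ⟨hi₀, Finset.mem_univ _⟩)
    · exact Finset.map_subset_map.2 (Finset.erase_subset _ _)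
    · ext x
      simp only [hp, Finset.mem_map, Finset.mem_erase, Finset.mem_univ, and_true,
        Function.Embedding.coeFn_mk, exists_exists_and_eq_and]
      constructor
      · rintro ⟨i, hi, rfl⟩
        exact ⟨i, hi, by rw [hu, he i hi]⟩
      · rintro ⟨i, hi, rfl⟩
        exact ⟨i, hi, by rw [hu, he i hi]⟩
  have key : ∀ i, i ≠ j → w.1 (M.v i) = z.1 (M.v i) := by
    intro i hi
    rw [← M.vertex_eq_iff]
    apply φ'.injective
    rw [h2', ← h'.pt_eq hs hi, ← h2]
    refine hφ.agree (s := p) hφ' (fun j => by rw [h1, h1']) (hsub hφ h2 fun _ _ => rfl)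
      (hsub hφ' h2' fun i hi => (h'.pt_eq hs hi).symm) ?_
    rw [h2]
    exact hmem i hi
  rcases eq_or_isWall key with h3 | h3
  · left; rwa [← h3]
  · right
    rwa [hs.unique h3, mul_inv_cancel_left]

/-- Retraction of a gallery. -/
theorem exists_folded_word : ∀ {L : List M.weylGroup}, M.IsWord L → ∀ {y : M.weylGroup}
    {c c' x : X.Chamber}, X.Rel L.prod c x → X.Rel y c' c →
    ∃ L', M.IsWord L' ∧ L'.length ≤ L.length ∧ X.Rel (y * L'.prod) c' x
  | [], _, y, c, c', x, h, h' => by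
    rw [List.prod_nil, rel_one_iff] at h
    subst h
    exact ⟨[], IsWord.nil, le_rfl, by rwa [List.prod_nil, mul_one]⟩
  | s :: L, hL, y, c, c', x, h, h' => by
    obtain ⟨j, hs⟩ := hL.head
    rw [List.prod_cons] at h
    obtain ⟨e, h1, h2⟩ := h.exists_between
    -- Either the gallery folds at this panel and the letter is dropped, or it passes through and
    -- the letter is kept.
    rcases h'.of_adjacent hs h1 with h3 | h3
    · obtain ⟨L', hL', hlen, hx⟩ := exists_folded_word hL.tail h2 h3
      exact ⟨L', hL', by rw [List.length_cons]; omega, hx⟩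
    · obtain ⟨L', hL', hlen, hx⟩ := exists_folded_word hL.tail h2 h3
      exact ⟨s :: L', hL'.cons hs, by simpa using hlen, by rwa [List.prod_cons, ← mul_assoc]⟩

/-- If the distance to c'' were still w, a reduced gallery of type w from c to c'', folded as seen
from c', would give w⁻¹ p = s with a word for p of length at most that of w. Then p = w s would not
be longer than w. -/
theorem Rel.mul_wall {j : Fin (d + 1)} {s w : M.weylGroup} (hs : M.IsWall j s)
    (hlen : M.len w < M.len (w * s)) {c c' c'' : X.Chamber} (h : X.Rel w c c')
    (h' : X.Rel s c' c'') : X.Rel (w * s) c c'' := by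
  rcases h.of_adjacent hs h' with h1 | h1
  · exfalso
    obtain ⟨L, hL, hw, hlenL⟩ := exists_reduced_word w
    rw [← hw] at h1
    obtain ⟨L', hL', hlen', hx⟩ := exists_folded_word hL h1 h.inv
    have h2 := hx.unique h'
    rw [inv_mul_eq_iff_eq_mul] at h2
    have h3 := len_prod_le hL'
    rw [h2] at h3
    omega
  · exact h1

theorem Rel.mul_of_reducedOver : ∀ {L : List M.weylGroup}, M.IsWord L → ∀ {u : M.weylGroup},
    M.IsReducedOver u L → ∀ {c c' c'' : X.Chamber}, X.Rel u c c' → X.Rel L.prod c' c'' →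
    X.Rel (u * L.prod) c c''
  | [], _, u, _, c, c', c'', h, h' => by
    rw [List.prod_nil, rel_one_iff] at h'
    subst h'
    rwa [List.prod_nil, mul_one]
  | s :: L, hL, u, hu, c, c', c'', h, h' => by
    obtain ⟨j, hs⟩ := hL.head
    rw [List.prod_cons] at h'
    obtain ⟨e, h1, h2⟩ := h'.exists_between
    rw [List.prod_cons, ← mul_assoc]
    exact Rel.mul_of_reducedOver hL.tail hu.2 (h.mul_wall hs hu.1 h1) h2

/-- By induction the two galleries merge after the first letter. If they started at different
chambers, these would be s-adjacent, and then c₂ would have both distances u and u s from c. -/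
theorem Rel.between_unique : ∀ {L : List M.weylGroup}, M.IsWord L → ∀ {u : M.weylGroup},
    M.IsReducedOver u L → ∀ {c c₁ c₂ c'' : X.Chamber}, X.Rel u c c₁ → X.Rel L.prod c₁ c'' →
    X.Rel u c c₂ → X.Rel L.prod c₂ c'' → c₁ = c₂
  | [], _, u, _, c, c₁, c₂, c'', _, h, _, h' => by
    rw [List.prod_nil, rel_one_iff] at h h'
    rw [h, h']
  | s :: L, hL, u, hu, c, c₁, c₂, c'', h1, h1', h2, h2' => by
    obtain ⟨j, hs⟩ := hL.head
    rw [List.prod_cons] at h1' h2'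
    obtain ⟨e₁, h3, h4⟩ := h1'.exists_between
    obtain ⟨e₂, h5, h6⟩ := h2'.exists_between
    have he := Rel.between_unique hL.tail hu.2 (h1.mul_wall hs hu.1 h3) h4
      (h2.mul_wall hs hu.1 h5) h6
    subst he
    by_contra hne
    have h7 : X.Rel s c₁ c₂ := rel_of_pt_eq hs
      (fun i hi => (h3.pt_eq hs hi).trans (h5.pt_eq hs hi).symm) hne
    have h8 := h2.unique (h1.mul_wall hs hu.1 h7)
    exact hs.1 (by simpa using h8)

/-! ### Local finiteness -/

/-- Chambers s-adjacent to a given chamber share a vertex with it, so local finiteness bounds each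
step of the gallery. -/
theorem finite_rel_word (hX : X.IsLocallyFinite) : ∀ {L : List M.weylGroup}, M.IsWord L →
    ∀ c : X.Chamber, {c' | X.Rel L.prod c c'}.Finite
  | [], _, c => by
    refine (Set.finite_singleton c).subset fun c' h => ?_
    exact (rel_one_iff.1 h).symm
  | s :: L, hL, c => by
    obtain ⟨j, hs⟩ := hL.head
    obtain ⟨i, hi⟩ := hs.exists_index_ne
    have hadj : {e | X.Rel s c e}.Finite := by
      refine Set.Finite.of_finite_image ((hX (c.pt i)).subset ?_)
        (f := fun e : X.Chamber => e.1) (Subtype.val_injective.injOn)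
      rintro _ ⟨e, he, rfl⟩
      refine ⟨e.2.1, ?_⟩
      rw [Rel.pt_eq hs he hi]
      exact e.pt_mem i
    refine (hadj.biUnion fun e _ => finite_rel_word hX hL.tail e).subset fun c' h => ?_
    have h' : X.Rel (s * L.prod) c c' := h
    obtain ⟨e, h1, h2⟩ := h'.exists_between
    exact Set.mem_biUnion h1 h2

theorem finite_rel (hX : X.IsLocallyFinite) (w : M.weylGroup) (c : X.Chamber) :
    {c' | X.Rel w c c'}.Finite := by
  obtain ⟨L, hL, rfl⟩ := exists_word w
  exact finite_rel_word hX hL c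

theorem finite_rel' (hX : X.IsLocallyFinite) (w : M.weylGroup) (c : X.Chamber) :
    {c' | X.Rel w c' c}.Finite :=
  (finite_rel hX w⁻¹ c).subset fun _ h => Rel.inv h

end AffineBuilding

/-! ### Sums and differences of admissible exponents. -/

namespace CoxeterSimplex

variable {d : ℕ} {M : CoxeterSimplex d}

theorem latticeVec_add (r : Fin d → ℚ) (k l : Fin d →₀ ℕ) :
    M.latticeVec r (k + l) = M.latticeVec r k + M.latticeVec r l := by
  simp only [latticeVec, Finsupp.add_apply, add_smul, Finset.sum_add_distrib]

theorem admissible_iff (hM : M.IsSpecial) {r : Fin d → ℚ} {k : Fin d →₀ ℕ} :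
    k ∈ M.admissible r ↔ ∃ t, M.IsTranslation t (M.latticeVec r k) :=
  mem_typeZeroLattice_iff hM

theorem admissible_add (hM : M.IsSpecial) {r : Fin d → ℚ} {k l : Fin d →₀ ℕ}
    (hk : k ∈ M.admissible r) (hl : l ∈ M.admissible r) : k + l ∈ M.admissible r := by
  rw [admissible_iff hM] at *
  obtain ⟨t, ht⟩ := hk
  obtain ⟨t', ht'⟩ := hl
  exact ⟨t * t', by rw [latticeVec_add]; exact ht.mul ht'⟩

theorem admissible_of_add (hM : M.IsSpecial) {r : Fin d → ℚ} {k l : Fin d →₀ ℕ}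
    (hk : k ∈ M.admissible r) (hkl : k + l ∈ M.admissible r) : l ∈ M.admissible r := by
  rw [admissible_iff hM] at *
  obtain ⟨t, ht⟩ := hk
  obtain ⟨t', ht'⟩ := hkl
  refine ⟨t⁻¹ * t', ?_⟩
  have := ht.inv.mul ht'
  rwa [latticeVec_add, neg_add_cancel_left] at this

end CoxeterSimplex

namespace AffineBuilding

open CoxeterSimplex

variable {d : ℕ} {M : CoxeterSimplex d} {V : Type*} {X : AffineBuilding M V}

/-! ### Translation operators -/

theorem relPos_iff {r : Fin d → ℚ} (hr : ∀ j, 0 < r j) {k : Fin d →₀ ℕ} {t : M.weylGroup}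
    (ht : M.IsTranslation t (M.latticeVec r k)) (c c' : X.Chamber) :
    X.RelPos r k c c' ↔ X.Rel t c c' := by
  constructor
  · rintro ⟨a, ha, φ, h1, h2, hc, w, hw, hc'⟩
    have hφ : X.IsChart a φ := ⟨ha, h1, h2⟩
    rw [isPosition_iff hr ht] at hw
    subst hw
    exact ⟨a, φ, hφ, (hφ.coe_eq_iff _ _).1 hc, (hφ.coe_eq_iff _ _).1 hc'⟩
  · rintro ⟨a, φ, hφ, h1, h2⟩
    exact ⟨a, hφ.mem, φ, hφ.iso, hφ.lab, (hφ.coe_eq_iff _ _).2 h1, t,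
      (isPosition_iff hr ht t).2 rfl, (hφ.coe_eq_iff _ _).2 h2⟩

open Classical in
theorem T_apply {r : Fin d → ℚ} {k : Fin d →₀ ℕ} (f : X.Chamber → ℂ) {c' : X.Chamber}
    {s : Finset X.Chamber} (hs : ∀ c, c ∈ s ↔ X.RelPos r k c c') :
    X.T r k f c' = ∑ c ∈ s, f c := by
  have h : {c | X.RelPos r k c c'}.Finite := s.finite_toSet.subset fun c hc => (hs c).2 hc
  have h1 : X.T r k f c' = if h : {c | X.RelPos r k c c'}.Finite then
    ∑ c ∈ h.toFinset, f c else 0 := rfl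
  rw [h1, dif_pos h]
  refine Finset.sum_congr ?_ fun _ _ => rfl
  ext c
  rw [Set.Finite.mem_toFinset, hs]
  rfl

/-- Composition of translation operators. -/
theorem T_mul_T (hM : M.IsSpecial) (hX : X.IsLocallyFinite) {r : Fin d → ℚ} (hr : ∀ j, 0 < r j)
    {k l : Fin d →₀ ℕ} (hk : k ∈ M.admissible r) (hl : l ∈ M.admissible r) :
    X.T r l * X.T r k = X.T r (k + l) := by
  classical
  obtain ⟨t, ht⟩ := (admissible_iff hM).1 hk
  obtain ⟨t', ht'⟩ := (admissible_iff hM).1 hl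
  have htt' : M.IsTranslation (t * t') (M.latticeVec r (k + l)) := by
    rw [latticeVec_add]; exact ht.mul ht'
  obtain ⟨L, hL, hLt, hred⟩ := exists_reducedOver hM ht ht' (isDominant_latticeVec hr k)
    (isDominant_latticeVec hr l)
  ext f c''
  rw [Module.End.mul_apply]
  have hfin := finite_rel' hX t' c''
  have hfink := fun c' => finite_rel' hX t c'
  rw [T_apply (s := hfin.toFinset) _ fun c => by
    rw [Set.Finite.mem_toFinset, relPos_iff hr ht']; rfl]
  rw [Finset.sum_congr rfl fun c' _ => T_apply (s := (hfink c').toFinset) f fun c => by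
    rw [Set.Finite.mem_toFinset, relPos_iff hr ht]; rfl]
  -- The double sum is a single sum over a union. The fibres over distinct intermediate chambers are
  -- disjoint by `Rel.between_unique`, and their union is right because distances multiply one way
  -- and `Rel.exists_between` gives the other.
  rw [T_apply (k := k + l) (s := hfin.toFinset.biUnion fun c' => (hfink c').toFinset),
    Finset.sum_biUnion]
  · intro c₁ h1 c₂ h2 hne
    rw [Finset.mem_coe, Set.Finite.mem_toFinset] at h1 h2
    refine Finset.disjoint_left.2 fun c hc1 hc2 => hne ?_
    rw [Set.Finite.mem_toFinset] at hc1 hc2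
    exact Rel.between_unique hL hred hc1 (by rw [hLt]; exact h1) hc2 (by rw [hLt]; exact h2)
  · intro c
    rw [relPos_iff hr htt', Finset.mem_biUnion]
    constructor
    · rintro ⟨c', h1, h2⟩
      rw [Set.Finite.mem_toFinset] at h1 h2
      rw [← hLt]
      exact Rel.mul_of_reducedOver hL hred h2 (by rw [hLt]; exact h1)
    · intro h
      obtain ⟨c', h1, h2⟩ := h.exists_between
      exact ⟨c', hfin.mem_toFinset.2 h2, (hfink c').mem_toFinset.2 h1⟩

/-! ### Type-preserving automorphisms -/

theorem Chamber.pt_smul {γ : X.aut} (hγ : ∀ v, X.lab (γ.1 v) = X.lab v) (c : X.Chamber)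
    (j : Fin (d + 1)) : (γ • c).pt j = γ.1 (c.pt j) := by
  have h : (γ • c).pt j ∈ c.1.map γ.1.toEmbedding := (γ • c).pt_mem j
  obtain ⟨x, hx, he⟩ := Finset.mem_map.1 h
  have h2 : x ∈ (c.1 : Set V) := hx
  rw [c.coe_eq] at h2
  obtain ⟨i, rfl⟩ := h2
  have he' : γ.1 (c.pt i) = (γ • c).pt j := he
  have h3 := hγ (c.pt i)
  rw [he', Chamber.lab_pt, Chamber.lab_pt] at h3
  rw [← he', h3]

theorem Rel.smul {γ : X.aut} (hγ : ∀ v, X.lab (γ.1 v) = X.lab v) {w : M.weylGroup}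
    {c c' : X.Chamber} (h : X.Rel w c c') : X.Rel w (γ • c) (γ • c') := by
  obtain ⟨a, φ, hφ, h1, h2⟩ := h
  refine ⟨_, φ.trans γ.1.toEmbedding, ⟨(γ.2.2 a).2 hφ.mem, ?_, fun w j => ?_⟩, fun j => ?_,
    fun j => ?_⟩
  · unfold IsIsoOnto
    conv_lhs => rw [hφ.iso]
    rw [Set.image_image]
    simp only [Finset.map_map]
  · exact (hγ _).trans (hφ.lab w j)
  · rw [Chamber.pt_smul hγ, ← h1]; rfl
  · rw [Chamber.pt_smul hγ, ← h2]; rfl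

theorem Rel.smul_iff {γ : X.aut} (hγ : ∀ v, X.lab (γ.1 v) = X.lab v) {w : M.weylGroup}
    {c c' : X.Chamber} : X.Rel w (γ • c) (γ • c') ↔ X.Rel w c c' := by
  refine ⟨fun h => ?_, Rel.smul hγ⟩
  have hγ' : ∀ v, X.lab ((γ⁻¹).1 v) = X.lab v := fun v => by
    rw [← hγ]
    congr 1
    exact Equiv.apply_symm_apply γ.1 v
  have := h.smul hγ'
  rwa [inv_smul_smul, inv_smul_smul] at this

/-- Type-preserving automorphisms preserve Weyl distance, so γ carries the index set of the sum at
c' bijectively to the one at γ c'. -/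
theorem preserves_of_typePreserving (hM : M.IsSpecial) (hX : X.IsLocallyFinite) {r : Fin d → ℚ}
    (hr : ∀ j, 0 < r j) {Γ : Subgroup X.aut} (hΓ : ∀ γ ∈ Γ, ∀ v, X.lab (γ.1 v) = X.lab v) :
    X.Preserves r Γ := by
  intro k hk f hf γ hγ c'
  obtain ⟨t, ht⟩ := (admissible_iff hM).1 hk
  have hs : ∀ c' : X.Chamber, ∀ c, c ∈ (finite_rel' hX t c').toFinset ↔ X.RelPos r k c c' :=
    fun c' c => by rw [Set.Finite.mem_toFinset, relPos_iff hr ht]; rfl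
  rw [T_apply f (hs _), T_apply f (hs _)]
  symm
  refine Finset.sum_bij (fun c _ => γ • c) (fun c hc => ?_) (fun _ _ _ _ h => smul_left_cancel γ h)
    (fun c hc => ⟨γ⁻¹ • c, ?_, smul_inv_smul γ c⟩) (fun c _ => (hf γ hγ c).symm)
  · rw [Set.Finite.mem_toFinset] at hc ⊢
    exact Rel.smul (hΓ γ hγ) hc
  · rw [Set.Finite.mem_toFinset] at hc ⊢
    refine (Rel.smul_iff (hΓ γ hγ)).1 ?_
    rw [smul_inv_smul]
    exact hc

/-! ### The coefficient ring and the dimension of the invariants. -/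

theorem TRes_mul (hM : M.IsSpecial) (hX : X.IsLocallyFinite) {r : Fin d → ℚ} (hr : ∀ j, 0 < r j)
    {Γ : Subgroup X.aut} (hT : X.Preserves r Γ) (k l : M.admissible r) :
    TRes hT k * TRes hT l = TRes hT ⟨k.1 + l.1, admissible_add hM k.2 l.2⟩ := by
  ext f : 2
  have h := T_mul_T hM hX hr l.2 k.2
  rw [add_comm] at h
  change (X.T r k.1 * X.T r l.1) f.1 = X.T r (k.1 + l.1) f.1
  rw [h]

theorem coeffRing_commute (hM : M.IsSpecial) (hX : X.IsLocallyFinite) {r : Fin d → ℚ}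
    (hr : ∀ j, 0 < r j) {Γ : Subgroup X.aut} (hT : X.Preserves r Γ) (A B : coeffRing hT) :
    A * B = B * A := by
  have hcomm : ∀ x ∈ Set.range (TRes hT), ∀ y ∈ Set.range (TRes hT), x * y = y * x := by
    rintro _ ⟨k, rfl⟩ _ ⟨l, rfl⟩
    rw [TRes_mul hM hX hr, TRes_mul hM hX hr]
    congr 2
    exact add_comm _ _
  exact (Subring.isMulCommutative_closure hcomm).is_comm.comm A B

/-- An invariant function is determined by its values at one representative of each orbit. -/
theorem finiteDimensional_invariants (Γ : Subgroup X.aut)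
    [Finite (MulAction.orbitRel.Quotient Γ X.Chamber)] :
    FiniteDimensional ℂ (X.invariants Γ) := by
  let F : X.invariants Γ →ₗ[ℂ] (MulAction.orbitRel.Quotient Γ X.Chamber → ℂ) :=
    { toFun := fun f q => f.1 q.out
      map_add' := fun _ _ => rfl
      map_smul' := fun _ _ => rfl }
  refine FiniteDimensional.of_injective F fun f g h => Subtype.ext (funext fun c => ?_)
  have h1 : f.1 (Quotient.mk _ c : MulAction.orbitRel.Quotient Γ X.Chamber).out =
      g.1 (Quotient.mk _ c : MulAction.orbitRel.Quotient Γ X.Chamber).out := congrFun h _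
  have h2 : (MulAction.orbitRel Γ X.Chamber).r
      (Quotient.mk _ c : MulAction.orbitRel.Quotient Γ X.Chamber).out c := Quotient.mk_out c
  obtain ⟨γ, hγ⟩ := h2
  rw [← hγ] at h1
  exact (f.2 γ.1 γ.2 c).symm.trans (h1.trans (g.2 γ.1 γ.2 c))

end AffineBuilding

/-! ### Rational power series -/

namespace MvPowerSeries

variable {σ R : Type*}

/-- The exponents of the variable `j` in the power series are bounded. -/
def BoundedIn [Semiring R] (j : σ) (G : MvPowerSeries σ R) : Prop :=
  ∃ B : ℕ, ∀ n : σ →₀ ℕ, B < n j → coeff n G = 0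

theorem BoundedIn.mul [Semiring R] {j : σ} {F G : MvPowerSeries σ R} (hF : F.BoundedIn j)
    (hG : G.BoundedIn j) : (F * G).BoundedIn j := by
  classical
  obtain ⟨B, hB⟩ := hF
  obtain ⟨C, hC⟩ := hG
  refine ⟨B + C, fun n hn => ?_⟩
  rw [coeff_mul]
  refine Finset.sum_eq_zero fun p hp => ?_
  rw [Finset.HasAntidiagonal.mem_antidiagonal] at hp
  rw [← hp, Finsupp.add_apply] at hn
  by_cases h : B < p.1 j
  · rw [hB _ h, zero_mul]
  · rw [hC _ (by omega), mul_zero]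

theorem boundedIn_monomial [Semiring R] (j : σ) (n : σ →₀ ℕ) (a : R) :
    (monomial n a).BoundedIn j := by
  classical
  refine ⟨n j, fun m hm => ?_⟩
  rw [coeff_monomial, if_neg]
  rintro rfl
  exact lt_irrefl _ hm

theorem BoundedIn.sum [Semiring R] {ι : Type*} {j : σ} {s : Finset ι}
    {F : ι → MvPowerSeries σ R} (h : ∀ i ∈ s, (F i).BoundedIn j) :
    (∑ i ∈ s, F i).BoundedIn j := by
  refine Finset.sum_induction F (BoundedIn j) ?_ ⟨0, fun n _ => coeff_zero n⟩ h
  rintro F G ⟨B, hB⟩ ⟨C, hC⟩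
  refine ⟨max B C, fun n hn => ?_⟩
  rw [map_add, hB n ((le_max_left _ _).trans_lt hn), hC n ((le_max_right _ _).trans_lt hn),
    add_zero]

theorem BoundedIn.prod [CommSemiring R] {ι : Type*} {j : σ} {s : Finset ι}
    {F : ι → MvPowerSeries σ R} (h : ∀ i ∈ s, (F i).BoundedIn j) :
    (∏ i ∈ s, F i).BoundedIn j :=
  Finset.prod_induction F (BoundedIn j) (fun _ _ => BoundedIn.mul) (boundedIn_monomial j 0 1) h

theorem finite_support_of_boundedIn [Semiring R] [Finite σ] {G : MvPowerSeries σ R}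
    (h : ∀ j, G.BoundedIn j) : {n | coeff n G ≠ 0}.Finite := by
  classical
  choose B hB using h
  refine (Set.finite_Iic (Finsupp.equivFunOnFinite.symm B)).subset fun n hn j => ?_
  by_contra! hlt
  exact hn (hB j n hlt)

end MvPowerSeries

open MvPowerSeries in
/-- A power series whose coefficients satisfy a linear recurrence in every variable is rational. -/
theorem isRationalSeries_of_recurrence {σ R : Type*} [Finite σ] [CommRing R]
    (F : MvPowerSeries σ R)
    (h : ∀ j, ∃ N : ℕ, 0 < N ∧ ∃ D : ℕ, ∃ c : ℕ → R, c D = 1 ∧ ∀ m : σ →₀ ℕ, 1 ≤ m j →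
      ∑ i ∈ Finset.range (D + 1), c i * coeff (m + Finsupp.single j (i * N)) F = 0) :
    IsRationalSeries F := by
  classical
  cases nonempty_fintype σ
  choose N hN D c hc hrec using h
  -- The reversed characteristic polynomial of the recurrence in u_j^N: the leading coefficient c D
  -- = 1 becomes the constant term.
  set q : σ → MvPowerSeries σ R := fun j =>
    ∑ i ∈ Finset.range (D j + 1), monomial (Finsupp.single j ((D j - i) * N j)) (c j i) with hq
  have hbq : ∀ i j, (q i).BoundedIn j := fun i j =>
    BoundedIn.sum fun _ _ => boundedIn_monomial _ _ _
  have hbF : ∀ j, (q j * F).BoundedIn j := by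
    intro j
    refine ⟨D j * N j, fun n hn => ?_⟩
    simp only [hq]
    rw [Finset.sum_mul, map_sum]
    have hle : Finsupp.single j (D j * N j) ≤ n := by
      rw [Finsupp.single_le_iff]; exact hn.le
    -- The strict bound n_j > D N leaves an exponent of at least 1 in the variable j, as the
    -- recurrence requires.
    rw [← hrec j (n - Finsupp.single j (D j * N j)) (by
      rw [Finsupp.tsub_apply, Finsupp.single_eq_same]; omega)]
    refine Finset.sum_congr rfl fun i hi => ?_
    have hi' : i ≤ D j := Nat.lt_succ_iff.1 (Finset.mem_range.1 hi)
    have hmul : (D j - i) * N j + i * N j = D j * N j := by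
      rw [← add_mul, Nat.sub_add_cancel hi']
    rw [coeff_monomial_mul, if_pos]
    · congr 1
      refine congrArg (fun e => coeff e F) ?_
      ext a
      by_cases ha : a = j
      · subst ha
        simp only [Finsupp.tsub_apply, Finsupp.add_apply, Finsupp.single_eq_same]
        omega
      · simp [Finsupp.single_eq_of_ne ha]
    · rw [Finsupp.single_le_iff]; omega
  refine ⟨(∏ j, q j) * F, ∏ j, q j, finite_support_of_boundedIn fun j => ?_,
    finite_support_of_boundedIn fun j => BoundedIn.prod fun i _ => hbq i j, ?_, rfl⟩
  · rw [← Finset.prod_erase_mul _ _ (Finset.mem_univ j), mul_assoc]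
    exact (BoundedIn.prod fun i _ => hbq i j).mul (hbF j)
  · rw [map_prod]
    refine Finset.prod_eq_one fun j _ => ?_
    simp only [hq]
    rw [map_sum, Finset.sum_eq_single (D j)]
    · rw [Nat.sub_self, zero_mul, Finsupp.single_zero, ← coeff_zero_eq_constantCoeff_apply,
        coeff_monomial_same, hc]
    · intro i hi hne
      rw [← coeff_zero_eq_constantCoeff_apply, coeff_monomial, if_neg]
      intro h0
      have h1 := DFunLike.congr_fun h0 j
      rw [Finsupp.single_eq_same, Finsupp.coe_zero, Pi.zero_apply] at h1
      rw [Finset.mem_range] at hi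
      have h2 : 0 < (D j - i) * N j := Nat.mul_pos (by omega) (hN j)
      omega
    · intro h0
      exact absurd (Finset.self_mem_range_succ _) h0

namespace CoxeterSimplex

variable {d : ℕ} {M : CoxeterSimplex d}

/-! ### The rank of the lattice -/

/-- Modulo Λ₀ and the stabilizer of v₀, every point can be moved into the compact simplex. A form
vanishing on Λ₀ is therefore bounded above, hence zero. -/
theorem linear_eq_zero_of_typeZeroLattice (hM : M.IsSpecial)
    (f : EuclideanSpace ℝ (Fin d) →ₗ[ℝ] ℝ) (hf : ∀ l ∈ M.typeZeroLattice, f l = 0) : f = 0 := by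
  have hbd : Bornology.IsBounded (convexHull ℝ (Set.range M.v)) :=
    isBounded_convexHull.2 (Set.finite_range _).isBounded
  obtain ⟨R, hR⟩ := hbd.subset_closedBall (M.v 0)
  set F := LinearMap.toContinuousLinearMap f
  have hF : ∀ x, F x = f x := fun _ => rfl
  have hle : ∀ x, f x ≤ ‖F‖ * (R + ‖M.v 0‖) := by
    intro x
    obtain ⟨w, hw, hwx⟩ := M.cover x
    set u : M.weylGroup := (⟨w, hw⟩ : M.weylGroup)⁻¹
    obtain ⟨u₀, h0, h1⟩ := exists_fixing_linear_eq hM u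
    have hux : u.1 (w x) = x := M.inv_apply_self ⟨w, hw⟩ x
    have h2 := CoxeterSimplex.linear_apply u.1 (w x - M.v 0) (M.v 0)
    have h3 := CoxeterSimplex.linear_apply u₀.1 (w x - M.v 0) (M.v 0)
    rw [← h1, h3, sub_add_cancel, h0, hux] at h2
    have h4 : x = u₀.1 (w x) + (u.1 (M.v 0) - M.v 0) := by
      rw [sub_eq_sub_iff_add_eq_add] at h2
      rw [← add_sub_assoc, h2]; abel
    have h5 : f x = F (u₀.1 (w x)) := by
      conv_lhs => rw [h4]
      rw [map_add, hf _ ⟨u.1, u.2, rfl⟩, add_zero, hF]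
    have h6 : ‖u₀.1 (w x)‖ ≤ R + ‖M.v 0‖ := by
      have h7 : dist (u₀.1 (w x)) (u₀.1 (M.v 0)) ≤ R := by
        rw [u₀.1.dist_map]; exact hR hwx
      rw [h0, dist_eq_norm] at h7
      calc ‖u₀.1 (w x)‖ = ‖(u₀.1 (w x) - M.v 0) + M.v 0‖ := by rw [sub_add_cancel]
        _ ≤ _ := (norm_add_le _ _).trans (by linarith)
    rw [h5]
    exact (Real.le_norm_self _).trans ((F.le_opNorm _).trans (by gcongr))
  ext x
  rw [LinearMap.zero_apply]
  by_contra hx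
  have h1 := hle (((‖F‖ * (R + ‖M.v 0‖) + 1) / f x) • x)
  rw [map_smul, smul_eq_mul, div_mul_cancel₀ _ hx] at h1
  linarith

theorem _root_.AddSubgroup.exists_nsmul_mem_of_mem_span {A : Type*} [AddCommGroup A] [Module ℚ A]
    (S : AddSubgroup A) {x : A} (hx : x ∈ Submodule.span ℚ (S : Set A)) :
    ∃ n : ℕ, 0 < n ∧ n • x ∈ S := by
  induction hx using Submodule.span_induction with
  | mem x h => exact ⟨1, one_pos, by simpa using h⟩
  | zero => exact ⟨1, one_pos, by simp⟩
  | add x y _ _ hx hy =>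
    obtain ⟨n, hn, hnx⟩ := hx
    obtain ⟨m, hm, hmy⟩ := hy
    refine ⟨n * m, Nat.mul_pos hn hm, ?_⟩
    rw [smul_add]
    refine S.add_mem ?_ ?_
    · rw [mul_comm, mul_smul]; exact S.nsmul_mem hnx m
    · rw [mul_smul]; exact S.nsmul_mem hmy n
  | smul q x _ hx =>
    obtain ⟨n, hn, hnx⟩ := hx
    refine ⟨q.den * n, Nat.mul_pos q.den_pos hn, ?_⟩
    have : (q.den * n) • q • x = q.num • n • x := by
      rw [← Nat.cast_smul_eq_nsmul ℚ, ← Nat.cast_smul_eq_nsmul ℚ, ← Int.cast_smul_eq_zsmul ℚ,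
        smul_smul, smul_smul]
      congr 1
      push_cast
      rw [mul_right_comm, Rat.den_mul_eq_num]
    rw [this]
    exact S.zsmul_mem hnx _

/-- A positive multiple of every basis vector lies in the lattice of type zero vertices. -/
theorem exists_single_admissible (hM : M.IsSpecial) {r : Fin d → ℚ} (hr : M.IsScale r)
    (j : Fin d) : ∃ N : ℕ, 0 < N ∧ Finsupp.single j N ∈ M.admissible r := by
  obtain ⟨⟨hpos, hsub⟩, -⟩ := hr
  set comb : (Fin d → ℚ) → EuclideanSpace ℝ (Fin d) := fun q => ∑ i, (q i : ℝ) • M.basisVec r i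
    with hcomb
  have hadd : ∀ p q, comb (p + q) = comb p + comb q := fun p q => by
    simp only [hcomb, Pi.add_apply, Rat.cast_add, add_smul, Finset.sum_add_distrib]
  have hneg : ∀ p, comb (-p) = -comb p := fun p => by
    simp only [hcomb, Pi.neg_apply, Rat.cast_neg, neg_smul, Finset.sum_neg_distrib]
  have hzero : comb 0 = 0 := by simp [hcomb]
  -- Rational coordinates are used because a multiple of e_j in Λ₀ must be found by clearing
  -- denominators; spanning over ℝ alone would not give one.
  let S : AddSubgroup (Fin d → ℚ) :=
    { carrier := {q | comb q ∈ M.typeZeroLattice}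
      add_mem' := fun {p q} hp hq => by
        rw [Set.mem_ofPred_eq, mem_typeZeroLattice_iff hM] at *
        obtain ⟨t, ht⟩ := hp
        obtain ⟨t', ht'⟩ := hq
        exact ⟨t * t', by rw [hadd]; exact ht.mul ht'⟩
      zero_mem' := by
        rw [Set.mem_ofPred_eq, mem_typeZeroLattice_iff hM, hzero]
        exact ⟨1, fun x => (add_zero x).symm⟩
      neg_mem' := fun {p} hp => by
        rw [Set.mem_ofPred_eq, mem_typeZeroLattice_iff hM] at *
        obtain ⟨t, ht⟩ := hp
        exact ⟨t⁻¹, by rw [hneg]; exact ht.inv⟩ }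
  have hspan : Submodule.span ℚ (S : Set (Fin d → ℚ)) = ⊤ := by
    by_contra hne
    obtain ⟨f, hf, hker⟩ := Submodule.exists_le_ker_of_lt_top _ (lt_top_iff_ne_top.2 hne)
    -- The real extension of f. Division by r_i compensates the scaling in e_i, so that g e_i is the
    -- value of f at the i-th unit vector.
    let g : EuclideanSpace ℝ (Fin d) →ₗ[ℝ] ℝ :=
      ∑ i, ((f (Pi.single i 1) / r i : ℚ) : ℝ) • (M.coord i.succ).linear
    have hbasis : ∀ i, g (M.basisVec r i) = (f (Pi.single i 1) : ℝ) := by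
      intro i
      rw [LinearMap.sum_apply, Finset.sum_eq_single i]
      · rw [LinearMap.smul_apply, basisVec, map_smul]
        have h2 : (M.coord i.succ).linear (M.v i.succ - M.v 0) =
            M.coord i.succ (M.v i.succ) - M.coord i.succ (M.v 0) :=
          (M.coord i.succ).linearMap_vsub _ _
        rw [h2, M.coord_self, M.coord_ne (Fin.succ_ne_zero i).symm, smul_eq_mul, smul_eq_mul]
        have h3 : (r i : ℝ) ≠ 0 := by exact_mod_cast (hpos i).ne'
        push_cast
        field_simp
        ring
      · intro k _ hk
        have h2 : (M.coord k.succ).linear (M.v i.succ - M.v 0) =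
            M.coord k.succ (M.v i.succ) - M.coord k.succ (M.v 0) :=
          (M.coord k.succ).linearMap_vsub _ _
        rw [LinearMap.smul_apply, basisVec, map_smul, h2,
          M.coord_ne (fun h => hk (Fin.succ_injective _ h).symm),
          M.coord_ne (Fin.succ_ne_zero k).symm, sub_zero, smul_zero, smul_zero]
      · simp
    have hgcomb : ∀ q, g (comb q) = (f q : ℝ) := by
      intro q
      simp only [hcomb]
      rw [map_sum]
      have h1 : f q = ∑ i, q i * f (Pi.single i 1) := by
        conv_lhs => rw [← Finset.univ_sum_single q]
        rw [map_sum]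
        refine Finset.sum_congr rfl fun i _ => ?_
        rw [← smul_eq_mul, ← map_smul, ← Pi.single_smul, smul_eq_mul, mul_one]
      rw [h1]
      push_cast
      refine Finset.sum_congr rfl fun i _ => ?_
      rw [map_smul, hbasis, smul_eq_mul]
    -- Through Λ₀ ⊆ Λ, every vector of Λ₀ comes from a rational coordinate vector, which then lies
    -- in S; so g vanishes on all of Λ₀.
    have hambient : ∀ l ∈ M.ambientLattice r, ∃ q, l = comb q := by
      intro l hl
      induction hl using AddSubgroup.closure_induction with
      | mem x hx =>
        obtain ⟨i, rfl⟩ := hx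
        refine ⟨Pi.single i 1, ?_⟩
        simp only [hcomb]
        rw [Finset.sum_eq_single i]
        · simp
        · intro k _ hk
          simp [Pi.single_eq_of_ne hk]
        · simp
      | zero => exact ⟨0, hzero.symm⟩
      | add x y _ _ hx hy =>
        obtain ⟨p, rfl⟩ := hx
        obtain ⟨q, rfl⟩ := hy
        exact ⟨p + q, (hadd p q).symm⟩
      | neg x _ hx =>
        obtain ⟨p, rfl⟩ := hx
        exact ⟨-p, (hneg p).symm⟩
    have hg0 : g = 0 := linear_eq_zero_of_typeZeroLattice hM g fun l hl => by
      obtain ⟨q, rfl⟩ := hambient l (hsub hl)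
      have hq : q ∈ Submodule.span ℚ (S : Set (Fin d → ℚ)) := Submodule.subset_span hl
      rw [hgcomb, LinearMap.mem_ker.1 (hker hq), Rat.cast_zero]
    apply hf
    refine LinearMap.ext fun q => ?_
    have := hgcomb q
    rw [hg0, LinearMap.zero_apply] at this
    rw [LinearMap.zero_apply]
    exact_mod_cast this.symm
  obtain ⟨N, hN, hmem⟩ := S.exists_nsmul_mem_of_mem_span (x := Pi.single j 1) (by
    rw [hspan]; exact Submodule.mem_top)
  refine ⟨N, hN, ?_⟩
  have h1 : comb (N • Pi.single j 1) ∈ M.typeZeroLattice := hmem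
  have h2 : comb (N • Pi.single j 1) = M.latticeVec r (Finsupp.single j N) := by
    simp only [hcomb, latticeVec]
    refine Finset.sum_congr rfl fun i _ => ?_
    by_cases hi : i = j
    · subst hi
      simp [Nat.cast_smul_eq_nsmul]
    · simp [Pi.single_eq_of_ne hi, Finsupp.single_eq_of_ne hi]
  rw [h2] at h1
  exact h1

end CoxeterSimplex

namespace AffineBuilding

variable {d : ℕ} {M : CoxeterSimplex d} {V : Type*} {X : AffineBuilding M V}

/-! ### Rationality -/

/-- The operator `T_{k,Γ}` as an element of the coefficient ring. -/
def coeffT {r : Fin d → ℚ} {Γ : Subgroup X.aut} (hT : X.Preserves r Γ) (k : M.admissible r) :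
    coeffRing hT := ⟨TRes hT k, Subring.subset_closure ⟨_, rfl⟩⟩

open MvPowerSeries in
-- The condition m_j ≥ 1 makes both exponents satisfy the positivity requirement simultaneously.
-- Admissibility transfers in both directions because N e_j is in the lattice, so zero coefficients
-- also match.
theorem coeff_TSeries_add (hM : M.IsSpecial) (hX : X.IsLocallyFinite) {r : Fin d → ℚ}
    (hr : ∀ j, 0 < r j) {Γ : Subgroup X.aut} (hT : X.Preserves r Γ) {j : Fin d} {N : ℕ}
    (hN : Finsupp.single j N ∈ M.admissible r) {m : Fin d →₀ ℕ} (hm : 1 ≤ m j) :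
    coeff (m + Finsupp.single j N) (TSeries hT) = coeffT hT ⟨_, hN⟩ * coeff m (TSeries hT) := by
  classical
  have hcoeff : ∀ n, coeff n (TSeries hT) =
      if h : n ∈ M.admissible r ∧ ∀ i, 1 ≤ n i then coeffT hT ⟨n, h.1⟩ else 0 := fun n => rfl
  have hiff : (m + Finsupp.single j N ∈ M.admissible r ∧ ∀ i, 1 ≤ (m + Finsupp.single j N) i) ↔
      (m ∈ M.admissible r ∧ ∀ i, 1 ≤ m i) := by
    constructor
    · rintro ⟨h1, h2⟩
      refine ⟨CoxeterSimplex.admissible_of_add hM hN (by rwa [add_comm]), fun i => ?_⟩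
      by_cases hi : i = j
      · rw [hi]; exact hm
      · simpa [Finsupp.single_eq_of_ne hi] using h2 i
    · rintro ⟨h1, h2⟩
      exact ⟨CoxeterSimplex.admissible_add hM h1 hN, fun i => (h2 i).trans (by simp)⟩
  rw [hcoeff, hcoeff]
  by_cases h : m ∈ M.admissible r ∧ ∀ i, 1 ≤ m i
  · rw [dif_pos (hiff.2 h), dif_pos h, coeffRing_commute hM hX hr]
    exact Subtype.ext (TRes_mul hM hX hr hT ⟨m, h.1⟩ ⟨_, hN⟩).symm
  · rw [dif_neg fun h1 => h (hiff.1 h1), dif_neg h, mul_zero]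

open MvPowerSeries in
theorem coeff_TSeries_add_mul (hM : M.IsSpecial) (hX : X.IsLocallyFinite) {r : Fin d → ℚ}
    (hr : ∀ j, 0 < r j) {Γ : Subgroup X.aut} (hT : X.Preserves r Γ) {j : Fin d} {N : ℕ}
    (hN : Finsupp.single j N ∈ M.admissible r) {m : Fin d →₀ ℕ} (hm : 1 ≤ m j) (i : ℕ) :
    coeff (m + Finsupp.single j (i * N)) (TSeries hT) =
      coeffT hT ⟨_, hN⟩ ^ i * coeff m (TSeries hT) := by
  induction i with
  | zero => simp
  | succ i ih =>
    rw [add_mul, one_mul, Finsupp.single_add, ← add_assoc, coeff_TSeries_add hM hX hr hT hN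
      (hm.trans (by simp)), ih, pow_succ', mul_assoc]

theorem isRationalSeries_TSeries (hM : M.IsSpecial) (hX : X.IsLocallyFinite) {r : Fin d → ℚ}
    (hr : M.IsScale r) {Γ : Subgroup X.aut} (hT : X.Preserves r Γ) :
    IsRationalSeries (TSeries hT) := by
  let _ : CommRing (coeffRing hT) :=
    { (inferInstance : Ring (coeffRing hT)) with
      mul_comm := coeffRing_commute hM hX hr.1.1 hT }
  refine isRationalSeries_of_recurrence (TSeries hT) fun j => ?_
  obtain ⟨N, hN0, hN⟩ := CoxeterSimplex.exists_single_admissible hM hr j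
  -- A recurrence of order one, with denominator 1 - T_{N e_j} u_j^N.
  refine ⟨N, hN0, 1, fun i => if i = 0 then -coeffT hT ⟨_, hN⟩ else 1, by simp, fun m hm => ?_⟩
  have h := coeff_TSeries_add hM hX hr.1.1 hT hN hm
  rw [Finset.sum_range_succ, Finset.sum_range_one]
  beta_reduce
  rw [if_pos rfl, if_neg one_ne_zero, one_mul, one_mul, zero_mul, Finsupp.single_zero, add_zero]
  refine (congrArg _ h).trans ?_
  rw [neg_mul, neg_add_cancel]

/-- Multiplying the Cayley–Hamilton relation of A = T_{N e_j} by the coefficient at m and taking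
traces gives the recurrence. -/
theorem isRationalSeries_zetaSeries (hM : M.IsSpecial) (hX : X.IsLocallyFinite) {r : Fin d → ℚ}
    (hr : M.IsScale r) {Γ : Subgroup X.aut} (hT : X.Preserves r Γ)
    [FiniteDimensional ℂ (X.invariants Γ)] : IsRationalSeries (zetaSeries hT) := by
  refine isRationalSeries_of_recurrence (zetaSeries hT) fun j => ?_
  obtain ⟨N, hN0, hN⟩ := CoxeterSimplex.exists_single_admissible hM hr j
  set A := TRes hT ⟨_, hN⟩
  refine ⟨N, hN0, A.charpoly.natDegree, fun i => A.charpoly.coeff i, A.charpoly_monic,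
    fun m hm => ?_⟩
  set B := (MvPowerSeries.coeff m (TSeries hT)).1
  have hcoeff : ∀ i, MvPowerSeries.coeff (m + Finsupp.single j (i * N)) (zetaSeries hT) =
      LinearMap.trace ℂ (X.invariants Γ) (A ^ i * B) := fun i => by
    have h := congrArg Subtype.val (coeff_TSeries_add_mul hM hX hr.1.1 hT hN hm i)
    exact congrArg (LinearMap.trace ℂ (X.invariants Γ)) h
  have h := A.aeval_self_charpoly
  rw [Polynomial.aeval_eq_sum_range] at h
  calc _ = LinearMap.trace ℂ (X.invariants Γ)
        ((∑ i ∈ Finset.range (A.charpoly.natDegree + 1), A.charpoly.coeff i • A ^ i) * B) := by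
        rw [Finset.sum_mul, map_sum]
        refine Finset.sum_congr rfl fun i _ => ?_
        rw [hcoeff, smul_mul_assoc, map_smul, smul_eq_mul]
    _ = 0 := by rw [h, zero_mul, map_zero]

end AffineBuilding

end

theorem mainTheorem5 {d : ℕ} (M : CoxeterSimplex d) (hM : M.IsSpecial)
    (r : Fin d → ℚ) (hr : M.IsScale r)
    {V : Type*} (X : AffineBuilding M V) (hX : X.IsLocallyFinite)
    (Γ : Subgroup X.aut) (hΓ : IsGroupLattice Γ) :
    -- the sums defining the operators `T_k` are finite
    (∀ k ∈ M.admissible r, ∀ c : X.Chamber,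
      {c' | X.RelPos r k c c'}.Finite ∧ {c' | X.RelPos r k c' c}.Finite) ∧
    -- the operators `T_k` act on the invariants of a type-preserving lattice
    ((∀ γ ∈ Γ, ∀ v, X.lab (γ.1 v) = X.lab v) → X.Preserves r Γ) ∧
    ∀ hT : X.Preserves r Γ,
      (∀ A B : AffineBuilding.coeffRing hT, A * B = B * A) ∧
      IsRationalSeries (AffineBuilding.TSeries hT) ∧
      (Finite (MulAction.orbitRel.Quotient Γ X.Chamber) →
        FiniteDimensional ℂ (X.invariants Γ) ∧
        IsRationalSeries (AffineBuilding.zetaSeries hT)) := by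
  have hr' : ∀ j, 0 < r j := hr.1.1
  refine ⟨fun k hk c => ?_, AffineBuilding.preserves_of_typePreserving hM hX hr', fun hT =>
    ⟨AffineBuilding.coeffRing_commute hM hX hr' hT,
      AffineBuilding.isRationalSeries_TSeries hM hX hr hT, fun hfin => ?_⟩⟩
  · obtain ⟨t, ht⟩ := (CoxeterSimplex.admissible_iff hM).1 hk
    simp only [AffineBuilding.relPos_iff hr' ht]
    exact ⟨AffineBuilding.finite_rel hX t c, AffineBuilding.finite_rel' hX t c⟩
  · have := AffineBuilding.finiteDimensional_invariants (X := X) Γ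
    exact ⟨this, AffineBuilding.isRationalSeries_zetaSeries hM hX hr hT⟩
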